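/- **Setting.** A conjunctive query is $\mathcal Q=\pi_{\mathcal O}(R_1(\mathcal A_1)\Join\cdots\Join R_n(\mathcal A_n))$ with finite attribute sets $\mathcal A_i$ and output attributes $\mathcal O\subseteq\bigcup_i\mathcal A_i$. It is acyclic if it has a join tree: a tree $\mathcal T$ on the relations in which, for every attribute, the relations containing it are connected. In an instance every $R_i$ is a finite set of tuples (over a nonempty domain) annotated with elements of a commutative semiring; joins multiply annotations, projections $\pi$ add up the annotations of the tuples they identify, and semi-joins $R\ltimes R'$ keep the annotations of $R$. (A projection onto a set $X$ of attributes means onto those attributes of $X$ that the relation has.) Let $N$ be the total number of input tuples, $M$ the number of tuples of the query result, and $F$ the number of tuples of the full join $R_1\Join\cdots\Join R_n$. Running time counts unit-cost dictionary operations and written rows, so that $\pi$, $\ltimes$, $\Join$ take time linear in input plus output; choices that depend only on the query are free. **Algorithm (Yannakakis$^+$).** Let $\mathcal T$ be a rooted join tree of $\mathcal Q$. At any moment, $\mathcal A_i$ is the current attribute set of $R_i$, and $\bar{\mathcal A}_i$ is the union of the attribute sets of the other current relations. *First round.* Visit the relations in a post-order (or any order with every node before its parent). For a non-root $R_i$ with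 parent $R_p$: if $R_i$ is a leaf of the current tree and $\mathcal A_i\cap\mathcal O\subseteq\mathcal A_p$, set $R_p\gets R_p\Join\pi_{\mathcal A_p}R_i$ and delete $R_i$; otherwise set $R_i\gets\pi_{\mathcal O\cup\bar{\mathcal A}_i}R_i$ and then $R_p\gets R_p\ltimes R_i$. For the root $R_n$ set $R_n\gets\pi_{\mathcal O\cup\bar{\mathcal A}_n}R_n$. *Second round.* A current relation $R_i$ is dangling-free if, on every input instance, each of its tuples is the projection of a tuple of the full join of the current relations. A neighbour $R_j$ of $R_i$ in the current tree is reducible for $R_i$ if $\mathcal A_k\cap\mathcal A_i\subseteq\mathcal O$ for every other neighbour $R_k$ of $R_i$. Repeat while possible: if some dangling-free $R_i$ has a reducible neighbour, choose such a pair $R_i,R_j$ and merge the two nodes into one node with the relation $$R_i'=\pi_{K}(R_i\Join R_j),\qquad K=\mathcal O\cup(\mathcal A_i\,\Delta\,\mathcal A_j)\cup\bigcup_{k\neq i,j}\mathcal A_k ;$$ otherwise choose a dangling-free $R_i$ with a child $R_j$ that is not dangling-free and set $R_j\gets R_j\ltimes R_i$. **Theorem.** For every acyclic conjunctive query $\mathcal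 Q$ there is a constant $C$, depending only on $\mathcal Q$, such that for every rooted join tree, every visiting order in the first round, every domain and every commutative semiring, the following holds for every sequence of choices in the second round. The algorithm terminates with exactly one relation; on every instance, this relation is the annotated result of $\mathcal Q$; and the total running time of both rounds is at most $$C\cdot\bigl(N+\min(NM,F)\bigr).$$ In particular, it is at most $C\cdot\min(NM,F)$ on instances with $M\ge 1$ and $N\le F$. -/

import Mathlib

universe uA uI uV uS

namespace YannakakisPlus

/-! ### Conjunctive queries, join trees, annotated database instances -/

/-- A conjunctive query `π_out (⋈ i, R i)`: relation `R i` has attribute set `attrs i`, and `out` is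
the set of output attributes. -/
structure CQ (α : Type uA) (ι : Type uI) [DecidableEq α] [Fintype ι] where
  attrs : ι → Finset α
  out : Finset α
  out_subset : out ⊆ Finset.univ.biUnion attrs

/-- A rooted join tree of `Q`: a rooted tree on the relations of `Q`, given by its parent map, such
that for every attribute the relations that contain it form a connected part of the tree. -/
structure JoinTree {α : Type uA} {ι : Type uI} [DecidableEq α] [Fintype ι] (Q : CQ α ι) where
  root : ι
  parent : ι → Option ι
  parent_eq_none : ∀ i, parent i = none ↔ i = root
  reaches_root : ∀ i, Relation.ReflTransGen (fun j k => parent j = some k) i root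
  connected : ∀ a : α,
    ((SimpleGraph.fromRel (fun j k => parent j = some k)).induce {i | a ∈ Q.attrs i}).Preconnected

/-- `order` lists every node of the tree exactly once, each node before its parent. Every
post-order of the tree is such an order. -/
def JoinTree.IsBottomUp {α : Type uA} {ι : Type uI} [DecidableEq α] [Fintype ι] {Q : CQ α ι}
    (T : JoinTree Q) (order : List ι) : Prop :=
  order.Nodup ∧ (∀ i, i ∈ order) ∧ order.Pairwise (fun i j => T.parent j ≠ some i)

/-- A tuple, as a partial assignment of values to attributes. -/
abbrev Tuple (α : Type uA) (V : Type uV) := α → Option V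

/-- A row of an annotated relation: a tuple and its annotation. -/
abbrev Row (α : Type uA) (V : Type uV) (S : Type uS) := Tuple α V × S

section tuples

variable {α : Type uA} {ι : Type uI} {V : Type uV} {S : Type uS} [DecidableEq α]

/-- The projection of a tuple to the attributes in `X`. -/
def restrict (X : Finset α) (t : Tuple α V) : Tuple α V := fun a => if a ∈ X then t a else none

/-- The union of two tuples (used for tuples that agree on their common attributes). -/
def glue (t u : Tuple α V) : Tuple α V := fun a => (t a).orElse (fun _ => u a)

/-- The tuples of a listed relation. -/
def tuples (R : List (Row α V S)) : List (Tuple α V) := R.map Prod.fst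

/-- The tuples in the full join of the relations `i ∈ nodes`: those on the union of the attribute
sets whose projection to each `attrs i` is a tuple of relation `i`. -/
def fullJoin (nodes : Finset ι) (attrs : ι → Finset α) (rows : ι → List (Row α V S)) :
    Set (Tuple α V) :=
  {t | (∀ a, (t a).isSome ↔ ∃ i ∈ nodes, a ∈ attrs i) ∧
    ∀ i ∈ nodes, restrict (attrs i) t ∈ tuples (rows i)}

theorem fullJoin_finite (nodes : Finset ι) (attrs : ι → Finset α)
    (rows : ι → List (Row α V S)) : (fullJoin nodes attrs rows).Finite := by
  let f : Tuple α V → (nodes → Tuple α V) := fun t i => restrict (attrs i) t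
  have hfin : (Set.pi Set.univ (fun i : nodes => {u | u ∈ tuples (rows i)})).Finite :=
    Set.Finite.pi' (fun i => List.finite_toSet _) |>.subset (fun g hg i => hg i trivial)
  refine Set.Finite.of_finite_image (f := f) (hfin.subset ?_) ?_
  · rintro _ ⟨t, ht, rfl⟩ i _
    exact ht.2 i i.2
  · intro t ht u hu h
    funext a
    by_cases ha : ∃ i ∈ nodes, a ∈ attrs i
    · obtain ⟨i, hi, hai⟩ := ha
      have := congrFun (congrFun h ⟨i, hi⟩) a
      simpa [f, restrict, hai] using this
    · have h1 := mt (ht.1 a).1 ha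
      have h2 := mt (hu.1 a).1 ha
      simp only [Option.not_isSome_iff_eq_none] at h1 h2
      rw [h1, h2]

end tuples

/-- A database instance for `Q`: each relation is a finite list of annotated tuples over its
attributes, without repeated tuples. -/
structure Instance {α : Type uA} {ι : Type uI} [DecidableEq α] [Fintype ι] (Q : CQ α ι)
    (V : Type uV) (S : Type uS) where
  rows : ι → List (Row α V S)
  isSome_iff : ∀ i, ∀ r ∈ rows i, ∀ a, (r.1 a).isSome ↔ a ∈ Q.attrs i
  nodup : ∀ i, (tuples (rows i)).Nodup

namespace Instance

variable {α : Type uA} {ι : Type uI} {V : Type uV} {S : Type uS}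
  [Fintype α] [DecidableEq α] [Fintype ι] [DecidableEq V] {Q : CQ α ι}

/-- The full join result, as a finite set of tuples. -/
noncomputable def joinResult (D : Instance Q V S) : Finset (Tuple α V) :=
  (fullJoin_finite Finset.univ Q.attrs D.rows).toFinset

/-- The tuples of the query result. -/
noncomputable def output (D : Instance Q V S) : Finset (Tuple α V) :=
  D.joinResult.image (restrict Q.out)

/-- The annotation of a tuple in a listed relation. -/
def annot [Zero S] (R : List (Row α V S)) (t : Tuple α V) : S := (R.lookup t).getD 0

/-- The annotation of `u` in the query result: the sum, over the full join tuples that project to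
`u`, of the product of the annotations of their constituents. -/
noncomputable def outputAnnot [CommSemiring S] (D : Instance Q V S) (u : Tuple α V) : S :=
  ∑ t ∈ D.joinResult with restrict Q.out t = u, ∏ i, annot (D.rows i) (restrict (Q.attrs i) t)

/-- The list `R` is the annotated result of the query `Q` on the instance `D`. -/
def IsResult [CommSemiring S] (D : Instance Q V S) (R : List (Row α V S)) : Prop :=
  (tuples R).Nodup ∧ (∀ u, u ∈ tuples R ↔ u ∈ D.output) ∧ ∀ r ∈ R, r.2 = D.outputAnnot r.1

/-- `N`: the total number of input tuples. -/
def inputSize (D : Instance Q V S) : ℕ := ∑ i, (D.rows i).length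

/-- `M`: the number of tuples of the query result. -/
noncomputable def outputSize (D : Instance Q V S) : ℕ := D.output.card

/-- `F`: the number of tuples of the full join. -/
noncomputable def joinSize (D : Instance Q V S) : ℕ := D.joinResult.card

end Instance

/-! ### The relational operators as step-counting programs

One step is one dictionary (hash table) operation or the writing of one row; work on a single tuple
or annotation has constant cost. -/

/-- A value together with the number of steps used to compute it. -/
structure Timed (β : Type uV) where
  val : β
  steps : ℕ

instance : Monad Timed where
  pure b := ⟨b, 0⟩
  bind x f := ⟨(f x.val).val, x.steps + (f x.val).steps⟩

section operators

variable {α : Type uA} {V : Type uV} {S : Type uS} [Fintype α] [DecidableEq α] [DecidableEq V]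

/-- The content of a dictionary after the entry of key `k` was replaced by `f` of the old entry. -/
def alterEntry {κ : Type uV} {ω : Type uS} [DecidableEq κ] (k : κ) (f : Option ω → ω) :
    List (κ × ω) → List (κ × ω)
  | [] => [(k, f none)]
  | e :: d => if e.1 = k then (k, f (some e.2)) :: d else e :: alterEntry k f d

/-- Update one dictionary entry: one step. -/
def timedAlter {κ : Type uV} {ω : Type uS} [DecidableEq κ] (k : κ) (f : Option ω → ω)
    (d : List (κ × ω)) : Timed (List (κ × ω)) := ⟨alterEntry k f d, 1⟩

/-- Look up one dictionary entry: one step. -/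
def timedLookup {κ : Type uV} {ω : Type uS} [DecidableEq κ] (k : κ) (d : List (κ × ω)) :
    Timed (Option ω) := ⟨d.lookup k, 1⟩

/-- Write rows: one step for each. -/
def timedWrite {β : Type uV} (l : List β) : Timed (List β) := ⟨l, l.length⟩

/-- Add the rows of a relation, projected to `Y`, into a dictionary from tuples to annotations. -/
def accumulate [Add S] (Y : Finset α) :
    List (Row α V S) → List (Tuple α V × S) → Timed (List (Tuple α V × S))
  | [], d => pure d
  | r :: R, d => do
    let d' ← timedAlter (restrict Y r.1) (fun o => o.elim r.2 (fun s => s + r.2)) d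
    accumulate Y R d'

/-- `π_Y R`: projection to `Y` with aggregation of the annotations by addition. -/
def project [Add S] (Y : Finset α) (R : List (Row α V S)) : Timed (List (Row α V S)) := do
  let d ← accumulate Y R []
  timedWrite d

/-- Put the rows of a relation into buckets by their projection to `Y`. -/
def buildIndex (Y : Finset α) : List (Row α V S) → List (Tuple α V × List (Row α V S)) →
    Timed (List (Tuple α V × List (Row α V S)))
  | [], d => pure d
  | r :: R, d => do
    let d' ← timedAlter (restrict Y r.1) (fun o => r :: o.getD []) d
    buildIndex Y R d'

/-- Join every row of a relation with the rows in its bucket. -/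
def probeJoin [Mul S] (Y : Finset α) (idx : List (Tuple α V × List (Row α V S))) :
    List (Row α V S) → Timed (List (Row α V S))
  | [] => pure []
  | r :: R => do
    let b ← timedLookup (restrict Y r.1) idx
    let w ← timedWrite ((b.getD []).map (fun q => (glue r.1 q.1, r.2 * q.2)))
    let rest ← probeJoin Y idx R
    pure (w ++ rest)

/-- `R ⋈ R'`, where `Y` is the set of common attributes; annotations are multiplied. -/
def join [Mul S] (Y : Finset α) (R R' : List (Row α V S)) : Timed (List (Row α V S)) := do
  let idx ← buildIndex Y R' []
  probeJoin Y idx R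

/-- Keep the rows of a relation that have a bucket. -/
def probeSemijoin (Y : Finset α) (idx : List (Tuple α V × List (Row α V S))) :
    List (Row α V S) → Timed (List (Row α V S))
  | [] => pure []
  | r :: R => do
    let b ← timedLookup (restrict Y r.1) idx
    let w ← timedWrite (if b.isSome then [r] else [])
    let rest ← probeSemijoin Y idx R
    pure (w ++ rest)

/-- `R ⋉ R'`, where `Y` is the set of common attributes; annotations of `R` are kept. -/
def semijoin (Y : Finset α) (R R' : List (Row α V S)) : Timed (List (Row α V S)) := do
  let idx ← buildIndex Y R' []
  probeSemijoin Y idx R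

end operators

/-! ### The algorithm -/

/-- The state of a query plan: the current join tree on the relations in `nodes` with its attribute
sets, both independent of the data, and, for every database instance, the current content of the
relations and the number of steps made so far. Data outside `nodes` is irrelevant. -/
structure State {α : Type uA} {ι : Type uI} [DecidableEq α] [Fintype ι] (Q : CQ α ι)
    (V : Type uV) (S : Type uS) where
  nodes : Finset ι
  parent : ι → Option ι
  attrs : ι → Finset α
  rows : Instance Q V S → ι → List (Row α V S)
  steps : Instance Q V S → ℕ

namespace State

variable {α : Type uA} {ι : Type uI} {V : Type uV} {S : Type uS}
  [Fintype α] [DecidableEq α] [Fintype ι] [DecidableEq ι] [DecidableEq V] [CommSemiring S]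
  {Q : CQ α ι}

/-- The state before the first round. -/
def start (Q : CQ α ι) (V : Type uV) (S : Type uS) (T : JoinTree Q) : State Q V S where
  nodes := Finset.univ
  parent := T.parent
  attrs := Q.attrs
  rows D := D.rows
  steps _ := 0

/-- Replace relation `i` by the result of the program `f`, over the attribute set `X`. -/
def assign (s : State Q V S) (i : ι) (X : Finset α)
    (f : (ι → List (Row α V S)) → Timed (List (Row α V S))) : State Q V S :=
  { s with
    attrs := Function.update s.attrs i X
    rows := fun D => Function.update (s.rows D) i (f (s.rows D)).val
    steps := fun D => s.steps D + (f (s.rows D)).steps }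

/-- The attributes that occur in a relation other than those in `I`. -/
def otherAttrs (s : State Q V S) (I : Finset ι) : Finset α := (s.nodes \ I).biUnion s.attrs

/-- `R i ← π_{O ∪ Ā i} (R i)`, where `Ā i` consists of the attributes of the other relations. -/
def aggregate (s : State Q V S) (i : ι) : State Q V S :=
  let K := Q.out ∪ s.otherAttrs {i}
  s.assign i (s.attrs i ∩ K) (fun R => project K (R i))

/-- `R j ← R j ⋉ R i`. -/
def filter (s : State Q V S) (j i : ι) : State Q V S :=
  s.assign j (s.attrs j) (fun R => semijoin (s.attrs j ∩ s.attrs i) (R j) (R i))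

/-- `R p ← R p ⋈ π_{A p} (R i)`, after which the leaf `i` is removed. -/
def absorb (s : State Q V S) (p i : ι) : State Q V S :=
  { s.assign p (s.attrs p) (fun R => do
      let R' ← project (s.attrs p) (R i)
      join (s.attrs p ∩ s.attrs i) (R p) R') with
    nodes := s.nodes.erase i }

/-- One iteration of the first round, for the relation `i`. -/
def firstRoundStep (s : State Q V S) (i : ι) : State Q V S :=
  match s.parent i with
  | some p =>
    if (∀ j ∈ s.nodes, s.parent j ≠ some i) ∧ s.attrs i ∩ Q.out ⊆ s.attrs p then
      s.absorb p i
    else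
      (s.aggregate i).filter p i
  | none => s.aggregate i

/-- The state after the first round, which visits the relations in the given order. -/
def firstRound (Q : CQ α ι) (V : Type uV) (S : Type uS) [DecidableEq V] [CommSemiring S]
    (T : JoinTree Q) (order : List ι) : State Q V S :=
  order.foldl firstRoundStep (start Q V S T)

/-- `j` is a neighbour of `i` in the current join tree. -/
def Neighbor (s : State Q V S) (i j : ι) : Prop :=
  i ∈ s.nodes ∧ j ∈ s.nodes ∧ (s.parent i = some j ∨ s.parent j = some i)

/-- Relation `i` is dangling-free: on every database instance, each of its tuples is the projection
of a tuple in the full join of the current relations. -/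
def DanglingFree (s : State Q V S) (i : ι) : Prop :=
  i ∈ s.nodes ∧ ∀ D : Instance Q V S, ∀ r ∈ s.rows D i,
    ∃ t ∈ fullJoin s.nodes s.attrs (s.rows D), restrict (s.attrs i) t = r.1

/-- `j` is reducible for `i`: it is a neighbour of `i`, and the attributes that `i` shares with its
other neighbours are output attributes. -/
def Reducible (s : State Q V S) (i j : ι) : Prop :=
  s.Neighbor i j ∧ ∀ k, s.Neighbor i k → k ≠ j → s.attrs k ∩ s.attrs i ⊆ Q.out

/-- Merge `R i` and its neighbour `R j` into `π_K (R i ⋈ R j)`, where `K` consists of the output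
attributes, the attributes in exactly one of `R i`, `R j`, and those of third relations. The new
relation takes the place of the upper one of the two nodes; the children of the lower one become
its children. -/
def merge (s : State Q V S) (i j : ι) : State Q V S :=
  let K := Q.out ∪ symmDiff (s.attrs i) (s.attrs j) ∪ s.otherAttrs {i, j}
  let upper := if s.parent i = some j then j else i
  let lower := if s.parent i = some j then i else j
  { s.assign upper ((s.attrs i ∪ s.attrs j) ∩ K) (fun R => do
      let J ← join (s.attrs i ∩ s.attrs j) (R i) (R j)
      project K J) with
    nodes := s.nodes.erase lower
    parent := fun k => if s.parent k = some lower then some upper else s.parent k }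

/-- One step of the second round. If some dangling-free relation has a reducible neighbour, then
such a pair is merged; otherwise a child that is not dangling-free is replaced by its semi-join with
a dangling-free parent. -/
inductive SecondRoundStep (s : State Q V S) : State Q V S → Prop
  | reduce (i j : ι) (hi : s.DanglingFree i) (hj : s.Reducible i j) :
      SecondRoundStep s (s.merge i j)
  | semijoinChild (i j : ι) (hnone : ∀ i' j', s.DanglingFree i' → ¬ s.Reducible i' j')
      (hi : s.DanglingFree i) (hj : j ∈ s.nodes) (hij : s.parent j = some i)
      (hjd : ¬ s.DanglingFree j) :
      SecondRoundStep s (s.filter j i)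

end State

end YannakakisPlus

open YannakakisPlus

set_option linter.unusedSectionVars false

namespace YannakakisPlus

/-! ### Dictionaries -/

section dictionaries

/-! Every state of the plan is read as a new acyclic query on the current relations. `Represents`
says that this query still has the annotated result of the original one and that its full join has
at most `F` tuples. Each operation preserves this: a semi-join removes only dangling tuples,
replacing two nodes by their join does not change the full join, and projecting away attributes that
are neither output attributes nor used elsewhere merges full join tuples whose weights add up by
distributivity (`Represents.project`).

In the first round no relation outgrows `N`, because absorbing a leaf only selects tuples of the
parent; a visit costs at most `5 N`. Afterwards the tree is reduced (`IsReduced`): every tuple has a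
match in each child. Hence the root is dangling-free, and a full join tuple can be changed inside
the subtree of a child so as to take any value there that matches at the parent
(`IsReduced.exists_extension`). So the join of a dangling-free parent with a child contains only
tuples that extend to the full join, at most `F` of them.

For the bound `N * M`, the first round also ensures that each non-output attribute of a relation
occurs in another one, hence in a neighbour. If `j` is reducible for `i`, then the attributes of `i`
lie in `O` together with those of `j` (`attrs_subset`). Each relation has a core (`HasCore`):
attributes that together with `O` cover it and onto which it has at most `N` projected tuples. The
core of `j` serves for the join. A joined tuple is determined by its core part and the output part
of a full join tuple extending it, so there are at most `N * M`.

The dangling-free node of a merged pair may be the lower one. Being dangling-free refers to all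
instances, so one test instance helps: the root relation is empty and every other relation has one
constant tuple. Its output is empty, so a relation that is nonempty there is not dangling-free. The
invariant `upward` keeps, on every edge, either a dangling-free parent or such an obstruction for
the child. Thus dangling-freeness passes upwards (`danglingFree_parent`), and the upper node of a
merged pair is always dangling-free.

Finally, the number of relations plus the number of those not dangling-free drops in every step, and
a step costs at most `5 (N + min (N * M) F)`. A state with more than one relation has a step: a
deepest leaf can be merged into its parent if all relations are dangling-free, and otherwise a
topmost offending relation can be filtered by its parent, unless a merge is possible. -/

theorem lookup_eq_some_of_mem {κ ω : Type*} [DecidableEq κ] {d : List (κ × ω)}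
    (hd : (d.map Prod.fst).Nodup) {e : κ × ω} (he : e ∈ d) : d.lookup e.1 = some e.2 := by
  induction d with
  | nil => simp at he
  | cons f d ih =>
    simp only [List.map_cons, List.nodup_cons] at hd
    rcases List.mem_cons.1 he with rfl | he'
    · simp [List.lookup]
    · have hne : (e.1 == f.1) = false := by
        rw [beq_eq_false_iff_ne]
        intro h
        exact hd.1 (h ▸ List.mem_map_of_mem he')
      obtain ⟨k, w⟩ := f
      simp only [List.lookup, hne]
      exact ih hd.2 he'

theorem lookup_isSome_iff {κ ω : Type*} [DecidableEq κ] {d : List (κ × ω)} {k : κ} :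
    (d.lookup k).isSome ↔ k ∈ d.map Prod.fst := by
  induction d with
  | nil => simp
  | cons f d ih =>
    obtain ⟨k', w⟩ := f
    by_cases h : k = k'
    · subst h; simp [List.lookup]
    · have hne : (k == k') = false := by simpa using h
      simp only [List.lookup, hne, ih]
      simp [h]

variable {κ : Type uV} {ω : Type uS} [DecidableEq κ]

theorem lookup_alterEntry (k : κ) (f : Option ω → ω) (d : List (κ × ω)) (k' : κ) :
    (alterEntry k f d).lookup k' = if k' = k then some (f (d.lookup k)) else d.lookup k' := by
  induction d with
  | nil => by_cases h : k' = k <;> simp [alterEntry, List.lookup, h, beq_eq_false_iff_ne.2]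
  | cons e d ih =>
    obtain ⟨l, w⟩ := e
    by_cases hl : l = k
    · subst hl
      by_cases h : k' = l
      · subst h; simp [alterEntry, List.lookup]
      · have hne : (k' == l) = false := by simpa using h
        simp [alterEntry, List.lookup, hne, h]
    · have hkl : (k == l) = false := by simpa using fun h : k = l => hl h.symm
      by_cases h : k' = l
      · subst h; simp [alterEntry, List.lookup, hl]
      · have hne : (k' == l) = false := by simpa using h
        simp [alterEntry, List.lookup, hl, hne, hkl, ih]

theorem mem_keys_alterEntry (k : κ) (f : Option ω → ω) (d : List (κ × ω)) (k' : κ) :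
    k' ∈ (alterEntry k f d).map Prod.fst ↔ k' = k ∨ k' ∈ d.map Prod.fst := by
  rw [← lookup_isSome_iff, ← lookup_isSome_iff, lookup_alterEntry]
  split_ifs with h <;> simp [h]

theorem nodup_keys_alterEntry (k : κ) (f : Option ω → ω) {d : List (κ × ω)}
    (hd : (d.map Prod.fst).Nodup) : ((alterEntry k f d).map Prod.fst).Nodup := by
  induction d with
  | nil => simp [alterEntry]
  | cons e d ih =>
    simp only [List.map_cons, List.nodup_cons] at hd
    unfold alterEntry
    split_ifs with h
    · subst h; simpa using hd
    · simp only [List.map_cons, List.nodup_cons, mem_keys_alterEntry, not_or]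
      exact ⟨⟨h, hd.1⟩, ih hd.2⟩

theorem length_alterEntry_le (k : κ) (f : Option ω → ω) (d : List (κ × ω)) :
    (alterEntry k f d).length ≤ d.length + 1 := by
  induction d with
  | nil => simp [alterEntry]
  | cons e d ih => unfold alterEntry; split_ifs <;> simp [ih]

end dictionaries

/-! ### Tuples and well-formed relations -/

section relations

variable {α : Type uA} {V : Type uV} {S : Type uS} [DecidableEq α]

theorem restrict_restrict (X Y : Finset α) (t : Tuple α V) :
    restrict X (restrict Y t) = restrict (X ∩ Y) t := by
  funext a
  by_cases h : a ∈ X <;> by_cases h' : a ∈ Y <;> simp [restrict, h, h']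

theorem restrict_restrict_of_subset {X Y : Finset α} (h : X ⊆ Y) (t : Tuple α V) :
    restrict X (restrict Y t) = restrict X t := by
  rw [restrict_restrict, Finset.inter_eq_left.2 h]

theorem restrict_eq_iff {X : Finset α} {t u : Tuple α V} :
    restrict X t = restrict X u ↔ ∀ a ∈ X, t a = u a := by
  constructor
  · intro h a ha
    simpa [restrict, ha] using congrFun h a
  · intro h
    funext a
    by_cases ha : a ∈ X <;> simp [restrict, ha, h]

/-- The tuple `t` is defined exactly on the attributes in `X`. -/
def IsOver (X : Finset α) (t : Tuple α V) : Prop := ∀ a, (t a).isSome ↔ a ∈ X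

theorem IsOver.eq_none {X : Finset α} {t : Tuple α V} (h : IsOver X t) {a : α} (ha : a ∉ X) :
    t a = none := by
  have := mt (h a).1 ha
  simpa using this

theorem IsOver.restrict_self {X : Finset α} {t : Tuple α V} (h : IsOver X t) :
    restrict X t = t := by
  funext a
  by_cases ha : a ∈ X <;> simp [restrict, ha, h.eq_none]

theorem IsOver.restrict {X : Finset α} {t : Tuple α V} (h : IsOver X t) (Y : Finset α) :
    IsOver (X ∩ Y) (restrict Y t) := by
  intro a
  by_cases ha : a ∈ Y <;> simp [YannakakisPlus.restrict, ha, h a]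

theorem IsOver.ext {X : Finset α} {t u : Tuple α V} (ht : IsOver X t) (hu : IsOver X u)
    (h : ∀ a ∈ X, t a = u a) : t = u := by
  rw [← ht.restrict_self, ← hu.restrict_self, restrict_eq_iff.2 h]

theorem IsOver.glue {X Y : Finset α} {t u : Tuple α V} (ht : IsOver X t) (hu : IsOver Y u) :
    IsOver (X ∪ Y) (glue t u) := by
  intro a
  cases h : t a with
  | none => have := ht a; have := hu a; simp_all [YannakakisPlus.glue]
  | some v => have := ht a; simp_all [YannakakisPlus.glue]

theorem IsOver.restrict_glue_left {X : Finset α} {t : Tuple α V} (ht : IsOver X t)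
    (u : Tuple α V) : YannakakisPlus.restrict X (YannakakisPlus.glue t u) = t := by
  funext a
  by_cases ha : a ∈ X
  · have := (ht a).2 ha
    cases h : t a <;> simp_all [YannakakisPlus.restrict, YannakakisPlus.glue]
  · simp [YannakakisPlus.restrict, ha, ht.eq_none ha]

theorem IsOver.restrict_glue_right {X Y : Finset α} {t u : Tuple α V} (ht : IsOver X t)
    (hu : IsOver Y u) (h : ∀ a ∈ X ∩ Y, t a = u a) :
    YannakakisPlus.restrict Y (YannakakisPlus.glue t u) = u := by
  funext a
  by_cases ha : a ∈ Y
  · by_cases hX : a ∈ X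
    · have h1 := (hu a).2 ha
      have h2 := h a (Finset.mem_inter.2 ⟨hX, ha⟩)
      cases h3 : u a <;> simp_all [YannakakisPlus.restrict, YannakakisPlus.glue]
    · simp [YannakakisPlus.restrict, YannakakisPlus.glue, ha, ht.eq_none hX]
  · simp [YannakakisPlus.restrict, ha, hu.eq_none ha]

/-- `R` is a list of annotated tuples over the attributes `X`, without repeated tuples. -/
structure WellFormed (X : Finset α) (R : List (Row α V S)) : Prop where
  isOver : ∀ t ∈ tuples R, IsOver X t
  nodup : (tuples R).Nodup

theorem mem_tuples {R : List (Row α V S)} {t : Tuple α V} :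
    t ∈ tuples R ↔ ∃ r ∈ R, r.1 = t := by
  simp [tuples]

theorem mem_tuples_of_mem {R : List (Row α V S)} {r : Row α V S} (h : r ∈ R) :
    r.1 ∈ tuples R := List.mem_map_of_mem h

theorem WellFormed.eq_of_fst_eq {X : Finset α} {R : List (Row α V S)} (h : WellFormed X R)
    {r q : Row α V S} (hr : r ∈ R) (hq : q ∈ R) (e : r.1 = q.1) : r = q :=
  List.inj_on_of_nodup_map h.nodup hr hq e

theorem WellFormed.length_le [Fintype α] [DecidableEq V] {X : Finset α} {R : List (Row α V S)}
    (h : WellFormed X R) {F : Finset (Tuple α V)} (hF : ∀ t ∈ tuples R, t ∈ F) :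
    R.length ≤ F.card := by
  have h1 : (tuples R).toFinset.card = R.length := by
    rw [List.toFinset_card_of_nodup h.nodup]; simp [tuples]
  rw [← h1]
  exact Finset.card_le_card fun t ht => hF t (by simpa using ht)

end relations

/-! ### The operators -/

section operators

variable {α : Type uA} {V : Type uV} {S : Type uS} [Fintype α] [DecidableEq α] [DecidableEq V]

theorem annot_eq [Zero S] {X : Finset α} {R : List (Row α V S)} (h : WellFormed X R)
    {r : Row α V S} (hr : r ∈ R) : Instance.annot R r.1 = r.2 := by
  simp [Instance.annot, lookup_eq_some_of_mem h.nodup hr]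

theorem accumulate_keys [Add S] (Y : Finset α) (R : List (Row α V S))
    (d : List (Tuple α V × S)) (t : Tuple α V) :
    t ∈ tuples (accumulate Y R d).val ↔ (∃ r ∈ R, restrict Y r.1 = t) ∨ t ∈ tuples d := by
  induction R generalizing d with
  | nil => simp [accumulate, pure]
  | cons r R ih =>
    have : (accumulate Y (r :: R) d).val = (accumulate Y R (alterEntry (restrict Y r.1)
      (fun o => o.elim r.2 (fun s => s + r.2)) d)).val := rfl
    rw [this, ih, tuples, mem_keys_alterEntry]
    simp only [List.exists_mem_cons_iff, tuples, eq_comm (a := t)]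
    rw [or_left_comm, or_assoc]

theorem accumulate_nodup [Add S] (Y : Finset α) (R : List (Row α V S))
    {d : List (Tuple α V × S)} (hd : (tuples d).Nodup) :
    (tuples (accumulate Y R d).val).Nodup := by
  induction R generalizing d with
  | nil => simpa [accumulate, pure] using hd
  | cons r R ih => exact ih (nodup_keys_alterEntry _ _ hd)

theorem accumulate_length [Add S] (Y : Finset α) (R : List (Row α V S))
    (d : List (Tuple α V × S)) : (accumulate Y R d).val.length ≤ d.length + R.length := by
  induction R generalizing d with
  | nil => simp [accumulate, pure]
  | cons r R ih =>
    refine (ih _).trans ?_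
    have := length_alterEntry_le (restrict Y r.1) (fun o => o.elim r.2 (fun s => s + r.2)) d
    simp only [timedAlter, List.length_cons]
    omega

theorem accumulate_steps [Add S] (Y : Finset α) (R : List (Row α V S))
    (d : List (Tuple α V × S)) : (accumulate Y R d).steps = R.length := by
  induction R generalizing d with
  | nil => simp [accumulate, pure]
  | cons r R ih =>
    have : (accumulate Y (r :: R) d).steps = 1 + (accumulate Y R (alterEntry (restrict Y r.1)
      (fun o => o.elim r.2 (fun s => s + r.2)) d)).steps := rfl
    rw [this, ih, List.length_cons, add_comm]

/-- The old entry of `d` is kept as a summand to make the induction on the rows work; an absent key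
counts as `0`, the default value of `annot`. -/
theorem accumulate_annot [AddCommMonoid S] (Y : Finset α) (R : List (Row α V S))
    (d : List (Tuple α V × S)) (t : Tuple α V) :
    Instance.annot (accumulate Y R d).val t =
      Instance.annot d t + ((R.filter (fun r => restrict Y r.1 = t)).map Prod.snd).sum := by
  induction R generalizing d with
  | nil => simp [accumulate, pure]
  | cons r R ih =>
    have : (accumulate Y (r :: R) d).val = (accumulate Y R (alterEntry (restrict Y r.1)
      (fun o => o.elim r.2 (fun s => s + r.2)) d)).val := rfl
    rw [this, ih, Instance.annot, lookup_alterEntry]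
    by_cases h : restrict Y r.1 = t
    · subst h
      cases hl : d.lookup (restrict Y r.1) <;> simp [Instance.annot, hl, add_assoc]
    · simp [h, Ne.symm h, Instance.annot]

theorem project_val [Add S] (Y : Finset α) (R : List (Row α V S)) :
    (project Y R).val = (accumulate Y R []).val := rfl

theorem mem_tuples_project [Add S] {Y : Finset α} {R : List (Row α V S)} {t : Tuple α V} :
    t ∈ tuples (project Y R).val ↔ ∃ u ∈ tuples R, restrict Y u = t := by
  rw [project_val, accumulate_keys]
  simp [tuples]

theorem WellFormed.project [Add S] {X : Finset α} {R : List (Row α V S)} (h : WellFormed X R)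
    (Y : Finset α) : WellFormed (X ∩ Y) (project Y R).val where
  isOver t ht := by
    obtain ⟨u, hu, rfl⟩ := mem_tuples_project.1 ht
    exact (h.isOver u hu).restrict Y
  nodup := accumulate_nodup Y R (by simp [tuples])

theorem project_length_le [Add S] (Y : Finset α) (R : List (Row α V S)) :
    (project Y R).val.length ≤ R.length := by
  have := accumulate_length Y R []
  rwa [List.length_nil, zero_add] at this

theorem project_steps_le [Add S] (Y : Finset α) (R : List (Row α V S)) :
    (project Y R).steps ≤ 2 * R.length := by
  have h : (project Y R).steps = (accumulate Y R []).steps + (project Y R).val.length := rfl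
  have := project_length_le Y R
  rw [h, accumulate_steps]
  omega

/-- Distinct rows have distinct tuples, so the sum over rows is a sum over a finite set of tuples,
the form to which distributivity is applied in `Represents.project`. -/
theorem annot_project [AddCommMonoid S] {X : Finset α} {R : List (Row α V S)}
    (h : WellFormed X R) (Y : Finset α) (t : Tuple α V) :
    Instance.annot (project Y R).val t =
      ∑ u ∈ (tuples R).toFinset with restrict Y u = t, Instance.annot R u := by
  rw [project_val, accumulate_annot]
  have h0 : Instance.annot ([] : List (Row α V S)) t = 0 := rfl
  rw [h0, zero_add]
  have h1 : (tuples R).toFinset.filter (fun u => restrict Y u = t) =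
      ((R.filter (fun r => restrict Y r.1 = t)).map Prod.fst).toFinset := by
    ext u
    simp [tuples]
  have hn : ((R.filter (fun r => restrict Y r.1 = t)).map Prod.fst).Nodup :=
    h.nodup.sublist (List.filter_sublist.map _)
  rw [h1, List.sum_toFinset _ hn, List.map_map]
  congr 1
  refine List.map_congr_left fun r hr => ?_
  exact (annot_eq h (List.mem_filter.1 hr).1).symm

theorem buildIndex_steps (Y : Finset α) (R : List (Row α V S))
    (d : List (Tuple α V × List (Row α V S))) : (buildIndex Y R d).steps = R.length := by
  induction R generalizing d with
  | nil => simp [buildIndex, pure]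
  | cons r R ih =>
    have : (buildIndex Y (r :: R) d).steps = 1 + (buildIndex Y R (alterEntry (restrict Y r.1)
      (fun o => r :: o.getD []) d)).steps := rfl
    rw [this, ih, List.length_cons, add_comm]

theorem buildIndex_isSome (Y : Finset α) (R : List (Row α V S))
    (d : List (Tuple α V × List (Row α V S))) (t : Tuple α V) :
    ((buildIndex Y R d).val.lookup t).isSome ↔
      (∃ r ∈ R, restrict Y r.1 = t) ∨ (d.lookup t).isSome := by
  induction R generalizing d with
  | nil => simp [buildIndex, pure]
  | cons r R ih =>
    have : (buildIndex Y (r :: R) d).val = (buildIndex Y R (alterEntry (restrict Y r.1)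
      (fun o => r :: o.getD []) d)).val := rfl
    rw [this, ih, lookup_alterEntry]
    by_cases h : t = restrict Y r.1
    · simp [h]
    · simp [h, Ne.symm h]

theorem buildIndex_getD (Y : Finset α) (R : List (Row α V S))
    (d : List (Tuple α V × List (Row α V S))) (t : Tuple α V) :
    ((buildIndex Y R d).val.lookup t).getD [] =
      (R.filter (fun r => restrict Y r.1 = t)).reverse ++ (d.lookup t).getD [] := by
  induction R generalizing d with
  | nil => simp [buildIndex, pure]
  | cons r R ih =>
    have : (buildIndex Y (r :: R) d).val = (buildIndex Y R (alterEntry (restrict Y r.1)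
      (fun o => r :: o.getD []) d)).val := rfl
    rw [this, ih, lookup_alterEntry]
    by_cases h : t = restrict Y r.1
    · simp [h]
    · simp [h, Ne.symm h]

theorem probeJoin_val [Mul S] (Y : Finset α) (idx : List (Tuple α V × List (Row α V S)))
    (R : List (Row α V S)) : (probeJoin Y idx R).val = R.flatMap (fun r =>
      ((idx.lookup (restrict Y r.1)).getD []).map (fun q => (glue r.1 q.1, r.2 * q.2))) := by
  induction R with
  | nil => rfl
  | cons r R ih => rw [List.flatMap_cons, ← ih]; rfl

theorem probeJoin_steps [Mul S] (Y : Finset α) (idx : List (Tuple α V × List (Row α V S)))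
    (R : List (Row α V S)) :
    (probeJoin Y idx R).steps = R.length + (probeJoin Y idx R).val.length := by
  induction R with
  | nil => rfl
  | cons r R ih =>
    have h1 : (probeJoin Y idx (r :: R)).steps =
      1 + ((((idx.lookup (restrict Y r.1)).getD []).map
        (fun q => (glue r.1 q.1, r.2 * q.2))).length + ((probeJoin Y idx R).steps + 0)) := rfl
    have h2 : (probeJoin Y idx (r :: R)).val = ((idx.lookup (restrict Y r.1)).getD []).map
        (fun q => (glue r.1 q.1, r.2 * q.2)) ++ (probeJoin Y idx R).val := rfl
    rw [h1, h2, ih, List.length_cons, List.length_append]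
    omega

theorem join_val [Mul S] (Y : Finset α) (R R' : List (Row α V S)) :
    (join Y R R').val = R.flatMap (fun r =>
      (R'.filter (fun q => restrict Y q.1 = restrict Y r.1)).reverse.map
        (fun q => (glue r.1 q.1, r.2 * q.2))) := by
  have h : (join Y R R').val = (probeJoin Y (buildIndex Y R' []).val R).val := rfl
  rw [h, probeJoin_val]
  simp only [buildIndex_getD, List.lookup_nil, Option.getD_none, List.append_nil]

theorem join_steps [Mul S] (Y : Finset α) (R R' : List (Row α V S)) :
    (join Y R R').steps = R'.length + R.length + (join Y R R').val.length := by
  have h : (join Y R R').steps = (buildIndex Y R' []).steps +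
    (probeJoin Y (buildIndex Y R' []).val R).steps := rfl
  have h2 : (join Y R R').val = (probeJoin Y (buildIndex Y R' []).val R).val := rfl
  rw [h, h2, buildIndex_steps, probeJoin_steps, add_assoc]

theorem mem_join [Mul S] {Y : Finset α} {R R' : List (Row α V S)} {x : Row α V S} :
    x ∈ (join Y R R').val ↔ ∃ r ∈ R, ∃ q ∈ R', restrict Y q.1 = restrict Y r.1 ∧
      x = (glue r.1 q.1, r.2 * q.2) := by
  rw [join_val]
  simp only [List.mem_flatMap, List.mem_map, List.mem_reverse, List.mem_filter,
    decide_eq_true_eq]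
  constructor
  · rintro ⟨r, hr, q, ⟨hq, h⟩, rfl⟩; exact ⟨r, hr, q, hq, h, rfl⟩
  · rintro ⟨r, hr, q, hq, h, rfl⟩; exact ⟨r, hr, q, ⟨hq, h⟩, rfl⟩

/-- `J` is the annotated natural join of `R`, over `X`, and `R'`, over `X'`. -/
structure IsJoin [MulZeroClass S] (X X' : Finset α) (R R' J : List (Row α V S)) : Prop where
  wellFormed : WellFormed (X ∪ X') J
  mem_iff : ∀ t, IsOver (X ∪ X') t →
    (t ∈ tuples J ↔ restrict X t ∈ tuples R ∧ restrict X' t ∈ tuples R')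
  annot : ∀ t ∈ tuples J, Instance.annot J t =
    Instance.annot R (restrict X t) * Instance.annot R' (restrict X' t)

/-- Both constituents of a joined row can be recovered by restriction to `X` and `X'`, because they
agree on `X ∩ X'`. This excludes repeated tuples and allows membership and annotations to be read
off componentwise. -/
theorem WellFormed.isJoin [CommSemiring S] {X X' : Finset α} {R R' : List (Row α V S)}
    (h : WellFormed X R) (h' : WellFormed X' R') :
    IsJoin X X' R R' (join (X ∩ X') R R').val := by
  have key : ∀ x ∈ (join (X ∩ X') R R').val, ∃ r ∈ R, ∃ q ∈ R', restrict X x.1 = r.1 ∧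
      restrict X' x.1 = q.1 ∧ x = (glue r.1 q.1, r.2 * q.2) := by
    intro x hx
    obtain ⟨r, hr, q, hq, e, rfl⟩ := mem_join.1 hx
    have hr' := h.isOver _ (mem_tuples_of_mem hr)
    have hq' := h'.isOver _ (mem_tuples_of_mem hq)
    refine ⟨r, hr, q, hq, hr'.restrict_glue_left _, hr'.restrict_glue_right hq' ?_, rfl⟩
    intro a ha
    exact (restrict_eq_iff.1 e a ha).symm
  have hw : WellFormed (X ∪ X') (join (X ∩ X') R R').val := by
    refine ⟨?_, ?_⟩
    · intro t ht
      obtain ⟨x, hx, rfl⟩ := mem_tuples.1 ht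
      obtain ⟨r, hr, q, hq, -, -, rfl⟩ := key x hx
      exact (h.isOver _ (mem_tuples_of_mem hr)).glue (h'.isOver _ (mem_tuples_of_mem hq))
    · have hl : ∀ r ∈ R, ∀ q ∈ R', restrict (X ∩ X') q.1 = restrict (X ∩ X') r.1 →
          restrict X (glue r.1 q.1) = r.1 ∧ restrict X' (glue r.1 q.1) = q.1 := by
        intro r hr q hq e
        have hr' := h.isOver _ (mem_tuples_of_mem hr)
        have hq' := h'.isOver _ (mem_tuples_of_mem hq)
        exact ⟨hr'.restrict_glue_left _, hr'.restrict_glue_right hq'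
          fun a ha => (restrict_eq_iff.1 e a ha).symm⟩
      rw [tuples, join_val, List.map_flatMap, List.nodup_flatMap]
      constructor
      · intro r hr
        rw [List.map_map]
        refine List.Nodup.map_on ?_ ?_
        · intro q hq q' hq' e
          simp only [List.mem_reverse, List.mem_filter, decide_eq_true_eq] at hq hq'
          refine h'.eq_of_fst_eq hq.1 hq'.1 ?_
          rw [← (hl r hr q hq.1 hq.2).2, ← (hl r hr q' hq'.1 hq'.2).2]
          exact congrArg _ e
        · exact List.nodup_reverse.2 ((List.Nodup.of_map _ h'.nodup).filter _)
      · have hR : R.Nodup := List.Nodup.of_map _ h.nodup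
        refine List.Pairwise.imp_of_mem ?_ hR
        intro r r' hr hr' hne t ht ht'
        simp only [List.map_map, List.mem_map, List.mem_reverse, List.mem_filter,
          decide_eq_true_eq, Function.comp] at ht ht'
        obtain ⟨q, ⟨hq, hqe⟩, rfl⟩ := ht
        obtain ⟨q', ⟨hq', hqe'⟩, e⟩ := ht'
        refine hne (h.eq_of_fst_eq hr hr' ?_)
        rw [← (hl r hr q hq hqe).1, ← (hl r' hr' q' hq' hqe').1, e]
  refine ⟨hw, ?_, ?_⟩
  · intro t ht
    constructor
    · intro hm
      obtain ⟨x, hx, rfl⟩ := mem_tuples.1 hm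
      obtain ⟨r, hr, q, hq, e1, e2, -⟩ := key x hx
      rw [e1, e2]
      exact ⟨mem_tuples_of_mem hr, mem_tuples_of_mem hq⟩
    · rintro ⟨h1, h2⟩
      obtain ⟨r, hr, e1⟩ := mem_tuples.1 h1
      obtain ⟨q, hq, e2⟩ := mem_tuples.1 h2
      have e : restrict (X ∩ X') q.1 = restrict (X ∩ X') r.1 := by
        rw [e1, e2, restrict_restrict_of_subset Finset.inter_subset_left,
          restrict_restrict_of_subset Finset.inter_subset_right]
      have hx := mem_join.2 ⟨r, hr, q, hq, e, rfl⟩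
      obtain ⟨hx1, hx2⟩ : restrict X (glue r.1 q.1) = r.1 ∧ restrict X' (glue r.1 q.1) = q.1 := by
        have hr' := h.isOver _ (mem_tuples_of_mem hr)
        have hq' := h'.isOver _ (mem_tuples_of_mem hq)
        exact ⟨hr'.restrict_glue_left _, hr'.restrict_glue_right hq'
          fun a ha => (restrict_eq_iff.1 e a ha).symm⟩
      have : t = glue r.1 q.1 := by
        refine ht.ext (hw.isOver _ (mem_tuples_of_mem hx)) fun a ha => ?_
        rcases Finset.mem_union.1 ha with ha | ha
        · exact restrict_eq_iff.1 (e1.symm.trans hx1.symm) a ha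
        · exact restrict_eq_iff.1 (e2.symm.trans hx2.symm) a ha
      rw [this]
      exact mem_tuples_of_mem hx
  · intro t hm
    obtain ⟨x, hx, rfl⟩ := mem_tuples.1 hm
    obtain ⟨r, hr, q, hq, e1, e2, e3⟩ := key x hx
    rw [annot_eq hw hx, e1, e2, annot_eq h hr, annot_eq h' hq, e3]

/-- For merges in which the first relation of the join is the lower of the two nodes. -/
theorem IsJoin.symm [CommSemiring S] {X X' : Finset α} {R R' J : List (Row α V S)}
    (h : IsJoin X X' R R' J) : IsJoin X' X R' R J where
  wellFormed := Finset.union_comm X X' ▸ h.wellFormed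
  mem_iff t ht := by
    rw [h.mem_iff t (Finset.union_comm X X' ▸ ht), and_comm]
  annot t ht := by rw [h.annot t ht, mul_comm]

theorem semijoin_val (Y : Finset α) (R R' : List (Row α V S)) :
    (semijoin Y R R').val =
      R.filter (fun r => decide (∃ q ∈ R', restrict Y q.1 = restrict Y r.1)) := by
  have h : (semijoin Y R R').val = (probeSemijoin Y (buildIndex Y R' []).val R).val := rfl
  rw [h]
  induction R with
  | nil => rfl
  | cons r R ih =>
    have h2 : (probeSemijoin Y (buildIndex Y R' []).val (r :: R)).val =
      (if ((buildIndex Y R' []).val.lookup (restrict Y r.1)).isSome then [r] else []) ++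
        (probeSemijoin Y (buildIndex Y R' []).val R).val := rfl
    rw [h2, ih rfl]
    have := buildIndex_isSome Y R' [] (restrict Y r.1)
    by_cases hb : ∃ q ∈ R', restrict Y q.1 = restrict Y r.1
    · rw [if_pos (this.2 (Or.inl hb)), List.filter_cons_of_pos (by simpa using hb)]
      rfl
    · rw [if_neg (by rw [this]; simpa using hb), List.filter_cons_of_neg (by simpa using hb)]
      rfl

theorem semijoin_steps_le (Y : Finset α) (R R' : List (Row α V S)) :
    (semijoin Y R R').steps ≤ R'.length + 2 * R.length := by
  have h : (semijoin Y R R').steps = (buildIndex Y R' []).steps +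
    (probeSemijoin Y (buildIndex Y R' []).val R).steps := rfl
  rw [h, buildIndex_steps]
  generalize (buildIndex Y R' []).val = idx
  have : (probeSemijoin Y idx R).steps ≤ 2 * R.length := by
    induction R with
    | nil => exact le_refl _
    | cons r R ih =>
      have h2 : (probeSemijoin Y idx (r :: R)).steps =
        1 + ((if (idx.lookup (restrict Y r.1)).isSome then [r] else []).length +
          ((probeSemijoin Y idx R).steps + 0)) := rfl
      rw [h2, List.length_cons]
      have := ih rfl
      split_ifs <;> simp only [List.length_cons, List.length_nil] <;> omega
  omega

theorem mem_tuples_semijoin {Y : Finset α} {R R' : List (Row α V S)} {t : Tuple α V} :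
    t ∈ tuples (semijoin Y R R').val ↔
      t ∈ tuples R ∧ ∃ u ∈ tuples R', restrict Y u = restrict Y t := by
  rw [semijoin_val]
  simp only [mem_tuples, List.mem_filter, decide_eq_true_eq]
  constructor
  · rintro ⟨r, ⟨hr, q, hq, e⟩, rfl⟩
    exact ⟨⟨r, hr, rfl⟩, q.1, ⟨q, hq, rfl⟩, e⟩
  · rintro ⟨⟨r, hr, rfl⟩, u, ⟨q, hq, rfl⟩, e⟩
    exact ⟨r, ⟨hr, q, hq, e⟩, rfl⟩

theorem WellFormed.semijoin {X : Finset α} {R : List (Row α V S)} (h : WellFormed X R)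
    (Y : Finset α) (R' : List (Row α V S)) : WellFormed X (semijoin Y R R').val where
  isOver t ht := h.isOver t (mem_tuples_semijoin.1 ht).1
  nodup := by
    rw [semijoin_val]
    exact h.nodup.sublist (List.filter_sublist.map _)

theorem semijoin_length_le (Y : Finset α) (R R' : List (Row α V S)) :
    (semijoin Y R R').val.length ≤ R.length := by
  rw [semijoin_val]
  exact List.length_filter_le _ _

theorem annot_semijoin [Zero S] {X : Finset α} {R : List (Row α V S)} (h : WellFormed X R)
    (Y : Finset α) (R' : List (Row α V S)) {t : Tuple α V}
    (ht : t ∈ tuples (semijoin Y R R').val) :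
    Instance.annot (semijoin Y R R').val t = Instance.annot R t := by
  obtain ⟨r, hr, rfl⟩ := mem_tuples.1 ht
  rw [annot_eq (h.semijoin Y R') hr]
  rw [semijoin_val] at hr
  rw [annot_eq h (List.mem_filter.1 hr).1]

end operators

/-! ### Join trees -/

section trees

variable {α : Type uA} {ι : Type uI} [DecidableEq α] [DecidableEq ι]

/-- `parent` describes a tree on `nodes` with the given root, in which `rank` increases from parents
to children. -/
structure IsRootedTree (nodes : Finset ι) (parent : ι → Option ι) (root : ι) (rank : ι → ℕ) :
    Prop where
  root_mem : root ∈ nodes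
  parent_root : parent root = none
  exists_parent : ∀ i ∈ nodes, i ≠ root → ∃ p, parent i = some p
  parent_mem : ∀ i ∈ nodes, ∀ p, parent i = some p → p ∈ nodes
  rank_lt : ∀ i ∈ nodes, ∀ p, parent i = some p → rank p < rank i

/-- `k` is a topmost node with attribute `a`. -/
def IsTop (nodes : Finset ι) (parent : ι → Option ι) (A : ι → Finset α) (a : α) (k : ι) : Prop :=
  k ∈ nodes ∧ a ∈ A k ∧ ∀ p, parent k = some p → a ∉ A p

/-- A rooted tree in which, for every attribute, the nodes that have it are connected: there is at
most one topmost such node. -/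
structure IsJoinTree (nodes : Finset ι) (parent : ι → Option ι) (A : ι → Finset α) (root : ι)
    (rank : ι → ℕ) : Prop extends IsRootedTree nodes parent root rank where
  top_unique : ∀ a k l, IsTop nodes parent A a k → IsTop nodes parent A a l → k = l

/-- `k` lies in the subtree of `l`. -/
def IsBelow (parent : ι → Option ι) (k l : ι) : Prop :=
  Relation.ReflTransGen (fun x y => parent x = some y) k l

theorem IsBelow.eq_or_parent {parent : ι → Option ι} {k l : ι} (h : IsBelow parent k l) :
    k = l ∨ ∃ p, parent k = some p ∧ IsBelow parent p l := by
  rcases Relation.ReflTransGen.cases_head h with h | ⟨p, h, h'⟩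
  · exact Or.inl h
  · exact Or.inr ⟨p, h, h'⟩

variable {nodes : Finset ι} {parent : ι → Option ι} {A : ι → Finset α} {root : ι} {rank : ι → ℕ}

theorem IsRootedTree.rank_le (h : IsRootedTree nodes parent root rank) {k l : ι} (hk : k ∈ nodes)
    (hkl : IsBelow parent k l) : rank l ≤ rank k := by
  induction hkl using Relation.ReflTransGen.head_induction_on with
  | refl => exact le_refl _
  | head hp _ ih => exact (ih (h.parent_mem _ hk _ hp)).trans (h.rank_lt _ hk _ hp).le

theorem IsRootedTree.not_below (h : IsRootedTree nodes parent root rank) {i j : ι}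
    (hj : j ∈ nodes) (hij : parent j = some i) : ¬ IsBelow parent i j := fun hb =>
  absurd (h.rank_le (h.parent_mem _ hj _ hij) hb) (not_le.2 (h.rank_lt _ hj _ hij))

theorem IsRootedTree.ne_of_parent (h : IsRootedTree nodes parent root rank) {i j : ι}
    (hj : j ∈ nodes) (hij : parent j = some i) : i ≠ j := by
  rintro rfl
  exact lt_irrefl _ (h.rank_lt _ hj _ hij)

/-- Climbing through parents that have `a` ends at a topmost node, since `rank` decreases. By
`top_unique` all climbs end at the same node, which replaces arguments about paths in the connected
part of `a`. -/
theorem IsJoinTree.induction_to_top (h : IsJoinTree nodes parent A root rank) {a : α}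
    {motive : ι → Prop} (top : ∀ k, IsTop nodes parent A a k → motive k)
    (step : ∀ k p, k ∈ nodes → p ∈ nodes → a ∈ A k → a ∈ A p → parent k = some p → motive p →
      motive k) {k : ι} (hk : k ∈ nodes) (ha : a ∈ A k) : motive k := by
  induction hn : rank k using Nat.strong_induction_on generalizing k with
  | _ n ih =>
    by_cases ht : IsTop nodes parent A a k
    · exact top k ht
    · have : ∃ p, parent k = some p ∧ a ∈ A p := by
        by_contra! hc
        exact ht ⟨hk, ha, hc⟩
      obtain ⟨p, hp, hap⟩ := this
      have hpm := h.parent_mem _ hk _ hp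
      exact step k p hk hpm ha hap hp (ih _ (hn ▸ h.rank_lt _ hk _ hp) hpm hap rfl)

theorem IsJoinTree.exists_top (h : IsJoinTree nodes parent A root rank) {a : α} {k : ι}
    (hk : k ∈ nodes) (ha : a ∈ A k) :
    ∃ t, IsTop nodes parent A a t ∧ IsBelow parent k t := by
  refine h.induction_to_top (motive := fun k => ∃ t, IsTop nodes parent A a t ∧ IsBelow parent k t)
    (fun k hk => ⟨k, hk, .refl⟩) ?_ hk ha
  rintro k p - - - - hp ⟨t, ht, hb⟩
  exact ⟨t, ht, .head hp hb⟩

/-- An attribute that a node shares with a node outside its subtree is an attribute of its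
parent. -/
theorem IsJoinTree.mem_parent (h : IsJoinTree nodes parent A root rank) {a : α} {k l p : ι}
    (hk : k ∈ nodes) (hl : l ∈ nodes) (hp : parent k = some p) (hak : a ∈ A k) (hal : a ∈ A l)
    (hlk : ¬ IsBelow parent l k) : a ∈ A p := by
  by_contra hap
  -- If `p` lacks `a`, then `k` is topmost for `a`, so it is the topmost node above `l`, which puts
  -- `l` below `k`.
  obtain ⟨t, ht, hb⟩ := h.exists_top hl hal
  refine hlk (h.top_unique a k t ⟨hk, hak, fun q hq => ?_⟩ ht ▸ hb)
  rw [hp] at hq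
  exact Option.some.inj hq ▸ hap

/-- An attribute that a node shares with a node in its subtree is an attribute of a child. -/
theorem IsJoinTree.mem_child (h : IsJoinTree nodes parent A root rank) {a : α} {k l : ι}
    (hk : k ∈ nodes) (hl : l ∈ nodes) (hne : l ≠ k) (hak : a ∈ A k) (hal : a ∈ A l)
    (hlk : IsBelow parent l k) : ∃ c ∈ nodes, parent c = some k ∧ a ∈ A c := by
  induction hlk using Relation.ReflTransGen.head_induction_on with
  | refl => exact absurd rfl hne
  | @head x y hxy hyk ih =>
    by_cases hy : y = k
    · subst hy; exact ⟨x, hl, hxy, hal⟩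
    · refine ih (h.parent_mem _ hl _ hxy) hy (h.mem_parent hl hk hxy hal hak fun hb => ?_)
      have h1 := h.rank_lt _ hl _ hxy
      have h2 := h.rank_le (h.parent_mem _ hl _ hxy) hyk
      have h3 := h.rank_le hk hb
      omega

/-- An attribute that a node shares with another one is an attribute of a neighbour. -/
theorem IsJoinTree.mem_neighbor (h : IsJoinTree nodes parent A root rank) {a : α} {k l : ι}
    (hk : k ∈ nodes) (hl : l ∈ nodes) (hne : l ≠ k) (hak : a ∈ A k) (hal : a ∈ A l) :
    ∃ c ∈ nodes, (parent k = some c ∨ parent c = some k) ∧ a ∈ A c := by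
  by_cases hb : IsBelow parent l k
  · obtain ⟨c, hc, hp, ha⟩ := h.mem_child hk hl hne hak hal hb
    exact ⟨c, hc, Or.inr hp, ha⟩
  · cases hp : parent k with
    | some p =>
      exact ⟨p, h.parent_mem _ hk _ hp, Or.inl rfl, h.mem_parent hk hl hp hak hal hb⟩
    | none =>
      obtain ⟨t, ht, hbt⟩ := h.exists_top hl hal
      exact absurd (h.top_unique a k t ⟨hk, hak, by simp [hp]⟩ ht ▸ hbt) hb

/-! ### Projection, leaf deletion and edge contraction in join trees -/

/-- Attributes of a single node may be dropped from a join tree. -/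
theorem IsJoinTree.project (h : IsJoinTree nodes parent A root rank) {i : ι} {Y : Finset α}
    (hY : ∀ a ∈ A i, a ∉ Y → ∀ k ∈ nodes, k ≠ i → a ∉ A k) :
    IsJoinTree nodes parent (Function.update A i (A i ∩ Y)) root rank := by
  have hsub : ∀ k, Function.update A i (A i ∩ Y) k ⊆ A k := by
    intro k
    by_cases hk : k = i
    · subst hk; simp
    · simp [hk]
  have hT : ∀ a k, IsTop nodes parent (Function.update A i (A i ∩ Y)) a k →
      IsTop nodes parent A a k := by
    rintro a k ⟨hk, ha, ht⟩
    refine ⟨hk, hsub k ha, fun p hp hap => ?_⟩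
    have hpm := h.parent_mem k hk p hp
    have hne := h.ne_of_parent hk hp
    have h1 := ht p hp
    by_cases hpi : p = i
    -- A dropped attribute occurs in no other node, in particular not in the child `k`.
    · subst hpi
      rw [Function.update_self, Finset.mem_inter, not_and] at h1
      exact hY a hap (h1 hap) k hk hne.symm (hsub k ha)
    · rw [Function.update_of_ne hpi] at h1
      exact h1 hap
  exact ⟨h.toIsRootedTree, fun a k l hk hl => h.top_unique a k l (hT _ _ hk) (hT _ _ hl)⟩

/-- A leaf may be deleted from a join tree. -/
theorem IsJoinTree.erase (h : IsJoinTree nodes parent A root rank) {i p : ι}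
    (hp : parent i = some p) (hleaf : ∀ j ∈ nodes, parent j ≠ some i) :
    IsJoinTree (nodes.erase i) parent A root rank := by
  constructor
  · constructor
    · refine Finset.mem_erase.2 ⟨?_, h.root_mem⟩
      rintro rfl
      simp [h.parent_root] at hp
    · exact h.parent_root
    · exact fun k hk => h.exists_parent k (Finset.mem_of_mem_erase hk)
    · intro k hk q hq
      refine Finset.mem_erase.2 ⟨?_, h.parent_mem k (Finset.mem_of_mem_erase hk) q hq⟩
      rintro rfl
      exact hleaf k (Finset.mem_of_mem_erase hk) hq
    · exact fun k hk => h.rank_lt k (Finset.mem_of_mem_erase hk)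
  · rintro a k l ⟨hk, hk'⟩ ⟨hl, hl'⟩
    exact h.top_unique a k l ⟨Finset.mem_of_mem_erase hk, hk'⟩ ⟨Finset.mem_of_mem_erase hl, hl'⟩

/-- The parent map after the node `c` was merged into its parent `p`. -/
def contractParent (parent : ι → Option ι) (p c : ι) : ι → Option ι :=
  fun k => if parent k = some c then some p else parent k

/-- A node may be merged into its parent. -/
theorem IsJoinTree.contract (h : IsJoinTree nodes parent A root rank) {p c : ι} (hc : c ∈ nodes)
    (hp : parent c = some p) :
    IsJoinTree (nodes.erase c) (contractParent parent p c) (Function.update A p (A p ∪ A c)) root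
      rank := by
  have hpc := h.ne_of_parent hc hp
  have hpm := h.parent_mem c hc p hp
  constructor
  · constructor
    · refine Finset.mem_erase.2 ⟨?_, h.root_mem⟩
      rintro rfl
      simp [h.parent_root] at hp
    · simp [contractParent, h.parent_root]
    · intro k hk hkr
      obtain ⟨q, hq⟩ := h.exists_parent k (Finset.mem_of_mem_erase hk) hkr
      unfold contractParent
      split_ifs
      · exact ⟨p, rfl⟩
      · exact ⟨q, hq⟩
    · intro k hk q hq
      unfold contractParent at hq
      split_ifs at hq with hkc
      · rw [← Option.some.inj hq]
        exact Finset.mem_erase.2 ⟨hpc, hpm⟩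
      · refine Finset.mem_erase.2 ⟨?_, h.parent_mem k (Finset.mem_of_mem_erase hk) q hq⟩
        rintro rfl
        exact hkc hq
    · intro k hk q hq
      unfold contractParent at hq
      split_ifs at hq with hkc
      · rw [← Option.some.inj hq]
        exact (h.rank_lt c hc p hp).trans (h.rank_lt k (Finset.mem_of_mem_erase hk) c hkc)
      · exact h.rank_lt k (Finset.mem_of_mem_erase hk) q hq
  -- A topmost node after the contraction was topmost before, or it is `p` and one of `p`, `c` was
  -- topmost.
  · have hT : ∀ a k, IsTop (nodes.erase c) (contractParent parent p c)
        (Function.update A p (A p ∪ A c)) a k →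
        (k ≠ p ∧ k ≠ c ∧ IsTop nodes parent A a k) ∨
        (k = p ∧ ∃ l, (l = p ∨ l = c) ∧ IsTop nodes parent A a l) := by
      rintro a k ⟨hk', ha, ht⟩
      obtain ⟨hkc, hk⟩ := Finset.mem_erase.1 hk'
      by_cases hkp : k = p
      · subst hkp
        refine Or.inr ⟨rfl, ?_⟩
        rw [Function.update_self] at ha
        by_cases hak : a ∈ A k
        · refine ⟨k, Or.inl rfl, hk, hak, fun q hq haq => ?_⟩
          have hqk := h.ne_of_parent hk hq
          have hqc : q ≠ c := by
            rintro rfl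
            have h1 := h.rank_lt _ (Finset.mem_of_mem_erase hk') _ hq
            have h2 := h.rank_lt _ hc _ hp
            omega
          refine ht q ?_ ?_
          · unfold contractParent
            rw [if_neg (by rw [hq]; simpa using hqc), hq]
          · rwa [Function.update_of_ne hqk]
        · refine ⟨c, Or.inr rfl, hc, (Finset.mem_union.1 ha).resolve_left hak, fun q hq => ?_⟩
          rw [hp] at hq
          exact Option.some.inj hq ▸ hak
      · refine Or.inl ⟨hkp, hkc, hk, ?_, ?_⟩
        · rwa [Function.update_of_ne hkp] at ha
        · intro q hq haq
          by_cases hqc : q = c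
          · subst hqc
            refine ht p (by simp [contractParent, hq]) ?_
            rw [Function.update_self]
            exact Finset.mem_union_right _ haq
          · refine ht q (by simp [contractParent, hq, hqc]) ?_
            by_cases hqp : q = p
            · subst hqp
              rw [Function.update_self]
              exact Finset.mem_union_left _ haq
            · rwa [Function.update_of_ne hqp]
    intro a k l hk₀ hl₀
    rcases hT a k hk₀ with ⟨hkp, hkc, hk⟩ | ⟨rfl, k', hk', hk⟩ <;>
      rcases hT a l hl₀ with ⟨hlp, hlc, hl⟩ | ⟨rfl, l', hl', hl⟩
    · exact h.top_unique a k l hk hl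
    · have := h.top_unique a k l' hk hl
      subst this
      tauto
    · have := h.top_unique a l k' hl hk
      subst this
      tauto
    · rfl

end trees

/-! ### Full joins -/

section fullJoin

variable {α : Type uA} {ι : Type uI} {V : Type uV} {S : Type uS} [DecidableEq α] [DecidableEq ι]

variable {nodes : Finset ι} {parent : ι → Option ι} {A : ι → Finset α} {root : ι} {rank : ι → ℕ}
  {R : ι → List (Row α V S)}

theorem mem_fullJoin {t : Tuple α V} : t ∈ fullJoin nodes A R ↔
    IsOver (nodes.biUnion A) t ∧ ∀ i ∈ nodes, restrict (A i) t ∈ tuples (R i) := by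
  simp [fullJoin, IsOver]

theorem fullJoin_congr {A' : ι → Finset α} {R' : ι → List (Row α V S)}
    (hA : ∀ i ∈ nodes, A' i = A i) (hR : ∀ i ∈ nodes, R' i = R i) :
    fullJoin nodes A' R' = fullJoin nodes A R := by
  ext t
  rw [mem_fullJoin, mem_fullJoin, Finset.biUnion_congr rfl hA]
  refine and_congr_right fun _ => forall₂_congr fun i hi => ?_
  rw [hA i hi, hR i hi]

/-- Every tuple of a relation matches a tuple of each child. -/
def IsReduced (nodes : Finset ι) (parent : ι → Option ι) (A : ι → Finset α)
    (R : ι → List (Row α V S)) : Prop :=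
  ∀ c ∈ nodes, ∀ p, parent c = some p → ∀ u ∈ tuples (R p), ∃ v ∈ tuples (R c),
    ∀ a ∈ A p, a ∈ A c → v a = u a

/-- Every tuple of relation `i` extends to the full join. -/
def IsDanglingFree (nodes : Finset ι) (A : ι → Finset α) (R : ι → List (Row α V S)) (i : ι) :
    Prop :=
  ∀ u ∈ tuples (R i), ∃ t ∈ fullJoin nodes A R, restrict (A i) t = u

/-- A choice of matching tuples can be extended downwards along the tree. -/
theorem IsReduced.exists_selection (hR : IsReduced nodes parent A R)
    (h : IsRootedTree nodes parent root rank) (P : Finset ι) (hPn : P ⊆ nodes)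
    (hP : ∀ k ∈ P, ∀ p, parent k = some p → p ∈ P) (hr : root ∈ P) (σ : ι → Tuple α V)
    (hσ : ∀ k ∈ P, σ k ∈ tuples (R k))
    (hc : ∀ k ∈ P, ∀ p, parent k = some p → ∀ a ∈ A p, a ∈ A k → σ k a = σ p a) :
    ∃ σ' : ι → Tuple α V, (∀ k ∈ P, σ' k = σ k) ∧ (∀ k ∈ nodes, σ' k ∈ tuples (R k)) ∧
      ∀ k ∈ nodes, ∀ p, parent k = some p → ∀ a ∈ A p, a ∈ A k → σ' k a = σ' p a := by
  induction hn : (nodes \ P).card generalizing P σ with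
  | zero =>
    have : nodes ⊆ P := by simpa using hn
    exact ⟨σ, fun _ _ => rfl, fun k hk => hσ k (this hk), fun k hk => hc k (this hk)⟩
  | succ n ih =>
    have hne : (nodes \ P).Nonempty := Finset.card_pos.1 (by omega)
    -- A node of least rank outside `P` has its parent in `P`, so reducedness supplies a tuple that
    -- matches there.
    obtain ⟨k, hk, hmin⟩ := Finset.exists_min_image _ rank hne
    obtain ⟨hkn, hkP⟩ := Finset.mem_sdiff.1 hk
    obtain ⟨p, hp⟩ := h.exists_parent k hkn (fun e => hkP (e ▸ hr))
    have hpP : p ∈ P := by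
      by_contra hpP
      have h1 := hmin p (Finset.mem_sdiff.2 ⟨h.parent_mem k hkn p hp, hpP⟩)
      have h2 := h.rank_lt k hkn p hp
      omega
    obtain ⟨v, hv, hva⟩ := hR k hkn p hp (σ p) (hσ p hpP)
    have hne' : ∀ l ∈ P, l ≠ k := by
      rintro l hl rfl
      exact hkP hl
    have hup : ∀ l ∈ insert k P, ∀ q, parent l = some q → q ∈ P := by
      intro l hl q hq
      rcases Finset.mem_insert.1 hl with rfl | hl
      · rw [hp] at hq
        exact Option.some.inj hq ▸ hpP
      · exact hP l hl q hq
    have hmem : ∀ l ∈ insert k P, Function.update σ k v l ∈ tuples (R l) := by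
      intro l hl
      rcases Finset.mem_insert.1 hl with rfl | hl
      · rwa [Function.update_self]
      · rw [Function.update_of_ne (hne' l hl)]
        exact hσ l hl
    have hedge : ∀ l ∈ insert k P, ∀ q, parent l = some q → ∀ a ∈ A q, a ∈ A l →
        Function.update σ k v l a = Function.update σ k v q a := by
      intro l hl q hq a haq hal
      rw [Function.update_of_ne (hne' q (hup l hl q hq))]
      rcases Finset.mem_insert.1 hl with rfl | hl
      · rw [hp] at hq
        obtain rfl := Option.some.inj hq
        rw [Function.update_self]
        exact hva a haq hal
      · rw [Function.update_of_ne (hne' l hl)]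
        exact hc l hl q hq a haq hal
    have hcard : (nodes \ insert k P).card = n := by
      have : nodes \ insert k P = (nodes \ P).erase k := by
        ext l; simp only [Finset.mem_sdiff, Finset.mem_insert, Finset.mem_erase]; tauto
      rw [this, Finset.card_erase_of_mem hk, hn, Nat.add_sub_cancel]
    obtain ⟨σ', h1, h2, h3⟩ := ih (insert k P) (Finset.insert_subset hkn hPn)
      (fun l hl q hq => Finset.mem_insert_of_mem (hup l hl q hq))
      (Finset.mem_insert_of_mem hr) (Function.update σ k v) hmem hedge hcard
    refine ⟨σ', fun l hl => ?_, h2, h3⟩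
    rw [h1 l (Finset.mem_insert_of_mem hl), Function.update_of_ne (hne' l hl)]

/-- Tuples that match along the edges of a join tree are the projections of a tuple in the full
join. -/
theorem IsJoinTree.exists_mem_fullJoin (h : IsJoinTree nodes parent A root rank)
    (hw : ∀ k ∈ nodes, WellFormed (A k) (R k)) (σ : ι → Tuple α V)
    (hσ : ∀ k ∈ nodes, σ k ∈ tuples (R k))
    (hc : ∀ k ∈ nodes, ∀ p, parent k = some p → ∀ a ∈ A p, a ∈ A k → σ k a = σ p a) :
    ∃ t ∈ fullJoin nodes A R, ∀ k ∈ nodes, restrict (A k) t = σ k := by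
  -- Agreement along edges carries every value of `a` up to the unique topmost node with `a`, so all
  -- of them coincide.
  have hcons : ∀ a, ∀ k ∈ nodes, ∀ l ∈ nodes, a ∈ A k → a ∈ A l → σ k a = σ l a := by
    intro a
    have key : ∀ k ∈ nodes, a ∈ A k → ∃ t, IsTop nodes parent A a t ∧ σ k a = σ t a := by
      intro k hk ha
      refine h.induction_to_top
        (motive := fun k => ∃ t, IsTop nodes parent A a t ∧ σ k a = σ t a)
        (fun k hk => ⟨k, hk, rfl⟩) ?_ hk ha
      rintro k p hk - hak hap hp ⟨t, ht, e⟩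
      exact ⟨t, ht, (hc k hk p hp a hap hak).trans e⟩
    intro k hk l hl hak hal
    obtain ⟨t, ht, e⟩ := key k hk hak
    obtain ⟨t', ht', e'⟩ := key l hl hal
    rw [e, e', h.top_unique a t t' ht ht']
  have hex : ∀ a, ∃ o : Option V, (∀ k ∈ nodes, a ∈ A k → o = σ k a) ∧
      ((∀ k ∈ nodes, a ∉ A k) → o = none) := by
    intro a
    by_cases ha : ∃ k ∈ nodes, a ∈ A k
    · obtain ⟨k, hk, hak⟩ := ha
      exact ⟨σ k a, fun l hl hal => hcons a k hk l hl hak hal, fun h => absurd hak (h k hk)⟩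
    · push Not at ha
      exact ⟨none, fun k hk hak => absurd hak (ha k hk), fun _ => rfl⟩
  choose t ht1 ht2 using hex
  have hres : ∀ k ∈ nodes, restrict (A k) t = σ k := by
    intro k hk
    rw [← ((hw k hk).isOver _ (hσ k hk)).restrict_self]
    exact restrict_eq_iff.2 fun a ha => ht1 a k hk ha
  refine ⟨t, mem_fullJoin.2 ⟨fun a => ?_, fun k hk => (hres k hk).symm ▸ hσ k hk⟩, hres⟩
  rw [Finset.mem_biUnion]
  constructor
  · intro hs
    by_contra! hc
    simp [ht2 a hc] at hs
  · rintro ⟨k, hk, ha⟩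
    rw [ht1 a k hk ha]
    exact ((hw k hk).isOver _ (hσ k hk) a).2 ha

/-- The set `{root}` is closed under parents, so an arbitrary root tuple extends downwards to a
matching selection. -/
theorem IsReduced.root_isDanglingFree (hR : IsReduced nodes parent A R)
    (h : IsJoinTree nodes parent A root rank) (hw : ∀ k ∈ nodes, WellFormed (A k) (R k)) :
    IsDanglingFree nodes A R root := by
  intro u hu
  obtain ⟨σ, h1, h2, h3⟩ := hR.exists_selection h.toIsRootedTree {root}
    (Finset.singleton_subset_iff.2 h.root_mem)
    (by intro k hk p hp; rw [Finset.mem_singleton.1 hk, h.parent_root] at hp; cases hp)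
    (Finset.mem_singleton_self _) (fun _ => u)
    (by intro k hk; rw [Finset.mem_singleton.1 hk]; exact hu)
    (fun _ _ _ _ _ _ _ => rfl)
  obtain ⟨t, ht, hres⟩ := h.exists_mem_fullJoin hw σ h2 h3
  exact ⟨t, ht, (hres _ h.root_mem).trans (h1 _ (Finset.mem_singleton_self _))⟩

/-- If a tuple of the full join matches a tuple of a child at its parent, then there is a tuple of
the full join that extends both. -/
theorem IsReduced.exists_extension (hR : IsReduced nodes parent A R)
    (h : IsJoinTree nodes parent A root rank) (hw : ∀ k ∈ nodes, WellFormed (A k) (R k))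
    {p c : ι} (hc : c ∈ nodes) (hp : parent c = some p) {t : Tuple α V}
    (ht : t ∈ fullJoin nodes A R) {v : Tuple α V} (hv : v ∈ tuples (R c))
    (hvt : ∀ a ∈ A p, a ∈ A c → v a = t a) :
    ∃ t' ∈ fullJoin nodes A R, restrict (A p) t' = restrict (A p) t ∧ restrict (A c) t' = v := by
  classical
  have hpm := h.parent_mem c hc p hp
  have hpc := h.ne_of_parent hc hp
  -- The nodes not strictly below `c`: the tuple `t` is kept outside the subtree of `c`, `v` is put
  -- at `c`, and everything below is chosen anew.
  let P := nodes.filter fun k => k = c ∨ ¬ IsBelow parent k c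
  have hpP : p ∈ P := Finset.mem_filter.2 ⟨hpm, Or.inr (h.not_below hc hp)⟩
  have hcP : c ∈ P := Finset.mem_filter.2 ⟨hc, Or.inl rfl⟩
  have hup : ∀ k ∈ P, ∀ q, parent k = some q → q ∈ P ∧ q ≠ c := by
    intro k hk q hq
    obtain ⟨hkn, hk⟩ := Finset.mem_filter.1 hk
    have hqn := h.parent_mem k hkn q hq
    rcases hk with rfl | hk
    · rw [hp] at hq
      obtain rfl := Option.some.inj hq
      exact ⟨hpP, hpc⟩
    · have hb : ¬ IsBelow parent q c := fun hb => hk (.head hq hb)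
      refine ⟨Finset.mem_filter.2 ⟨hqn, Or.inr hb⟩, ?_⟩
      rintro rfl
      exact hb .refl
  have hrP : root ∈ P := by
    refine Finset.mem_filter.2 ⟨h.root_mem, Or.inr fun hb => ?_⟩
    rcases hb.eq_or_parent with e | ⟨q, hq, -⟩
    · rw [← e, h.parent_root] at hp; cases hp
    · rw [h.parent_root] at hq; cases hq
  obtain ⟨-, htR⟩ := mem_fullJoin.1 ht
  have hmem : ∀ k ∈ P, Function.update (fun k => restrict (A k) t) c v k ∈ tuples (R k) := by
    intro k hk
    by_cases hkc : k = c
    · subst hkc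
      rwa [Function.update_self]
    · rw [Function.update_of_ne hkc]
      exact htR k (Finset.mem_filter.1 hk).1
  have hedge : ∀ k ∈ P, ∀ q, parent k = some q → ∀ a ∈ A q, a ∈ A k →
      Function.update (fun k => restrict (A k) t) c v k a =
        Function.update (fun k => restrict (A k) t) c v q a := by
    intro k hk q hq a haq hak
    rw [Function.update_of_ne (hup k hk q hq).2]
    by_cases hkc : k = c
    · subst hkc
      rw [hp] at hq
      obtain rfl := Option.some.inj hq
      rw [Function.update_self]
      simpa [restrict, haq] using hvt a haq hak
    · rw [Function.update_of_ne hkc]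
      simp [restrict, haq, hak]
  obtain ⟨σ, h1, h2, h3⟩ := hR.exists_selection h.toIsRootedTree P (Finset.filter_subset _ _)
    (fun k hk q hq => (hup k hk q hq).1) hrP _ hmem hedge
  obtain ⟨t', ht', hres⟩ := h.exists_mem_fullJoin hw σ h2 h3
  refine ⟨t', ht', ?_, ?_⟩
  · rw [hres p hpm, h1 p hpP, Function.update_of_ne hpc]
  · rw [hres c hc, h1 c hcP, Function.update_self]

end fullJoin

/-! ### Transformations of the relations and the full join -/

section transformations

variable {α : Type uA} {ι : Type uI} {V : Type uV} {S : Type uS} [DecidableEq α] [DecidableEq ι]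

variable {nodes : Finset ι} {parent : ι → Option ι} {A : ι → Finset α} {root : ι} {rank : ι → ℕ}
  {R : ι → List (Row α V S)}

theorem fullJoin_filter {j : ι} {R' : List (Row α V S)}
    (hsub : ∀ t ∈ tuples R', t ∈ tuples (R j))
    (hkeep : ∀ t ∈ fullJoin nodes A R, restrict (A j) t ∈ tuples R') :
    fullJoin nodes A (Function.update R j R') = fullJoin nodes A R := by
  ext t
  constructor
  · intro ht
    obtain ⟨h1, h2⟩ := mem_fullJoin.1 ht
    refine mem_fullJoin.2 ⟨h1, fun i hi => ?_⟩
    have h3 := h2 i hi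
    by_cases hij : i = j
    · subst hij
      rw [Function.update_self] at h3
      exact hsub _ h3
    · rwa [Function.update_of_ne hij] at h3
  · intro ht
    obtain ⟨h1, h2⟩ := mem_fullJoin.1 ht
    refine mem_fullJoin.2 ⟨h1, fun i hi => ?_⟩
    by_cases hij : i = j
    · subst hij
      rw [Function.update_self]
      exact hkeep t ht
    · rw [Function.update_of_ne hij]
      exact h2 i hi

theorem biUnion_join {p c : ι} (hp : p ∈ nodes) (hc : c ∈ nodes) (hpc : p ≠ c) :
    (nodes.erase c).biUnion (Function.update A p (A p ∪ A c)) = nodes.biUnion A := by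
  ext a
  simp only [Finset.mem_biUnion, Finset.mem_erase]
  constructor
  · rintro ⟨k, ⟨-, hk⟩, ha⟩
    by_cases hkp : k = p
    · subst hkp
      rw [Function.update_self] at ha
      rcases Finset.mem_union.1 ha with ha | ha
      · exact ⟨k, hk, ha⟩
      · exact ⟨c, hc, ha⟩
    · rw [Function.update_of_ne hkp] at ha
      exact ⟨k, hk, ha⟩
  · rintro ⟨k, hk, ha⟩
    by_cases hkp : k = p ∨ k = c
    · refine ⟨p, ⟨hpc, hp⟩, ?_⟩
      rw [Function.update_self, Finset.mem_union]
      rcases hkp with rfl | rfl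
      · exact Or.inl ha
      · exact Or.inr ha
    · push Not at hkp
      exact ⟨k, ⟨hkp.2, hk⟩, by rwa [Function.update_of_ne hkp.1]⟩

theorem IsOver.restrict_of_subset {X Y : Finset α} {t : Tuple α V} (h : IsOver X t) (hY : Y ⊆ X) :
    IsOver Y (YannakakisPlus.restrict Y t) := by
  have := h.restrict Y
  rwa [Finset.inter_eq_right.2 hY] at this

theorem IsJoin.mem_iff' [Fintype α] [DecidableEq V] [MulZeroClass S] {X X' U : Finset α}
    {P Q J : List (Row α V S)} (h : IsJoin X X' P Q J) {t : Tuple α V} (ht : IsOver U t)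
    (hU : X ∪ X' ⊆ U) :
    restrict (X ∪ X') t ∈ tuples J ↔ restrict X t ∈ tuples P ∧ restrict X' t ∈ tuples Q := by
  rw [h.mem_iff _ (ht.restrict_of_subset hU),
    restrict_restrict_of_subset Finset.subset_union_left,
    restrict_restrict_of_subset Finset.subset_union_right]

theorem fullJoin_join [Fintype α] [DecidableEq V] [MulZeroClass S] {p c : ι} (hp : p ∈ nodes)
    (hc : c ∈ nodes) (hpc : p ≠ c) {J : List (Row α V S)}
    (hJ : IsJoin (A p) (A c) (R p) (R c) J) :
    fullJoin (nodes.erase c) (Function.update A p (A p ∪ A c)) (Function.update R p J) =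
      fullJoin nodes A R := by
  have hU : A p ∪ A c ⊆ nodes.biUnion A :=
    Finset.union_subset (Finset.subset_biUnion_of_mem A hp) (Finset.subset_biUnion_of_mem A hc)
  ext t
  rw [mem_fullJoin, mem_fullJoin, biUnion_join hp hc hpc]
  refine and_congr_right fun ht => ?_
  constructor
  · intro h i hi
    have h1 := h p (Finset.mem_erase.2 ⟨hpc, hp⟩)
    rw [Function.update_self, Function.update_self, hJ.mem_iff' ht hU] at h1
    by_cases hip : i = p
    · exact hip ▸ h1.1
    by_cases hic : i = c
    · exact hic ▸ h1.2
    have h2 := h i (Finset.mem_erase.2 ⟨hic, hi⟩)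
    rwa [Function.update_of_ne hip, Function.update_of_ne hip] at h2
  · intro h i hi
    by_cases hip : i = p
    · subst hip
      rw [Function.update_self, Function.update_self, hJ.mem_iff' ht hU]
      exact ⟨h i hp, h c hc⟩
    · rw [Function.update_of_ne hip, Function.update_of_ne hip]
      exact h i (Finset.mem_of_mem_erase hi)

theorem update_inter_subset (A : ι → Finset α) (i : ι) (Y : Finset α) (k : ι) :
    Function.update A i (A i ∩ Y) k ⊆ A k := by
  by_cases hk : k = i
  · subst hk; simp
  · simp [hk]

theorem biUnion_update_inter_subset (A : ι → Finset α) (i : ι) (Y : Finset α) :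
    nodes.biUnion (Function.update A i (A i ∩ Y)) ⊆ nodes.biUnion A :=
  Finset.biUnion_mono fun k _ => update_inter_subset A i Y k

/-- The relation `R'` consists of the projections to `Y` of the tuples of `R`. -/
def IsProjection (Y : Finset α) (R R' : List (Row α V S)) : Prop :=
  ∀ t, t ∈ tuples R' ↔ ∃ u ∈ tuples R, restrict Y u = t

theorem restrict_mem_fullJoin_project {i : ι} (hi : i ∈ nodes) {Y : Finset α}
    {R' : List (Row α V S)} (hR' : IsProjection Y (R i) R') {t : Tuple α V}
    (ht : t ∈ fullJoin nodes A R) :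
    restrict (nodes.biUnion (Function.update A i (A i ∩ Y))) t ∈
      fullJoin nodes (Function.update A i (A i ∩ Y)) (Function.update R i R') := by
  obtain ⟨h1, h2⟩ := mem_fullJoin.1 ht
  refine mem_fullJoin.2 ⟨h1.restrict_of_subset (biUnion_update_inter_subset A i Y),
    fun k hk => ?_⟩
  rw [restrict_restrict_of_subset (Finset.subset_biUnion_of_mem _ hk)]
  by_cases hki : k = i
  · subst hki
    rw [Function.update_self, Function.update_self]
    refine (hR' _).2 ⟨_, h2 k hk, ?_⟩
    rw [restrict_restrict, Finset.inter_comm]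
  · rw [Function.update_of_ne hki, Function.update_of_ne hki]
    exact h2 k hk

/-- The dropped attributes occur only in relation `i`, so `v` and `t` agree wherever both are
defined, and `v` may restore these attributes freely. `Represents.project` uses this to index the
fibre over `t` by such tuples `v`. -/
theorem glue_mem_fullJoin {i : ι} (hi : i ∈ nodes) {Y : Finset α} {R' : List (Row α V S)}
    (hw : WellFormed (A i) (R i)) (hY : ∀ a ∈ A i, a ∉ Y → ∀ k ∈ nodes, k ≠ i → a ∉ A k)
    {t : Tuple α V}
    (ht : t ∈ fullJoin nodes (Function.update A i (A i ∩ Y)) (Function.update R i R'))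
    {v : Tuple α V} (hv : v ∈ tuples (R i)) (hvt : restrict Y v = restrict (A i ∩ Y) t) :
    glue v t ∈ fullJoin nodes A R ∧
      restrict (nodes.biUnion (Function.update A i (A i ∩ Y))) (glue v t) = t ∧
      restrict (A i) (glue v t) = v := by
  obtain ⟨h1, h2⟩ := mem_fullJoin.1 ht
  have hvo := hw.isOver v hv
  have hU : A i ∪ nodes.biUnion (Function.update A i (A i ∩ Y)) = nodes.biUnion A := by
    refine Finset.Subset.antisymm (Finset.union_subset (Finset.subset_biUnion_of_mem A hi)
      (biUnion_update_inter_subset A i Y)) (Finset.biUnion_subset.2 fun k hk => ?_)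
    by_cases hki : k = i
    · exact hki ▸ Finset.subset_union_left
    · refine Finset.Subset.trans ?_ Finset.subset_union_right
      refine Finset.Subset.trans ?_ (Finset.subset_biUnion_of_mem _ hk)
      rw [Function.update_of_ne hki]
  have hcap : ∀ a ∈ A i ∩ nodes.biUnion (Function.update A i (A i ∩ Y)), v a = t a := by
    intro a ha
    obtain ⟨hai, hau⟩ := Finset.mem_inter.1 ha
    have haY : a ∈ Y := by
      by_contra haY
      obtain ⟨k, hk, hak⟩ := Finset.mem_biUnion.1 hau
      by_cases hki : k = i
      · subst hki
        rw [Function.update_self] at hak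
        exact haY (Finset.mem_inter.1 hak).2
      · rw [Function.update_of_ne hki] at hak
        exact hY a hai haY k hk hki hak
    have := congrFun hvt a
    simpa [restrict, haY, hai] using this
  have hg1 : restrict (nodes.biUnion (Function.update A i (A i ∩ Y))) (glue v t) = t :=
    hvo.restrict_glue_right h1 hcap
  have hg2 : restrict (A i) (glue v t) = v := hvo.restrict_glue_left t
  refine ⟨mem_fullJoin.2 ⟨hU ▸ hvo.glue h1, fun k hk => ?_⟩, hg1, hg2⟩
  by_cases hki : k = i
  · rw [hki, hg2]
    exact hv
  · have h3 := h2 k hk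
    have hs := Finset.subset_biUnion_of_mem (Function.update A i (A i ∩ Y)) hk
    rw [Function.update_of_ne hki] at h3 hs
    rw [Function.update_of_ne hki, ← hg1, restrict_restrict_of_subset hs] at h3
    exact h3

theorem exists_glue {i : ι} (hi : i ∈ nodes) {Y : Finset α} {R' : List (Row α V S)}
    (hR' : IsProjection Y (R i) R') {t : Tuple α V}
    (ht : t ∈ fullJoin nodes (Function.update A i (A i ∩ Y)) (Function.update R i R')) :
    ∃ v ∈ tuples (R i), restrict Y v = restrict (A i ∩ Y) t := by
  have h1 := (mem_fullJoin.1 ht).2 i hi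
  rw [Function.update_self, Function.update_self] at h1
  exact (hR' _).1 h1

/-! ### Preservation of reducedness and of dangling-free relations -/

theorem IsReduced.mono (h : IsReduced nodes parent A R) {W : Finset ι} (hW : W ⊆ nodes) :
    IsReduced W parent A R := fun c hc => h c (hW hc)

/-- Shrinking `R j` does no harm to the edges towards its children, because the remaining tuples had
matches before. Only the edge towards its parent needs `hkeep`. -/
theorem IsReduced.filter (h : IsReduced nodes parent A R) {j : ι} {R' : List (Row α V S)}
    (hsub : ∀ t ∈ tuples R', t ∈ tuples (R j)) (hne : ∀ k ∈ nodes, parent k ≠ some k)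
    (hkeep : j ∈ nodes → ∀ p, parent j = some p → ∀ u ∈ tuples (R p), ∃ v ∈ tuples R',
      ∀ a ∈ A p, a ∈ A j → v a = u a) :
    IsReduced nodes parent A (Function.update R j R') := by
  intro c hc p hp u hu
  by_cases hcj : c = j
  · subst hcj
    have hpc : p ≠ c := by
      rintro rfl
      exact hne p hc hp
    rw [Function.update_of_ne hpc] at hu
    rw [Function.update_self]
    exact hkeep hc p hp u hu
  · rw [Function.update_of_ne hcj]
    by_cases hpj : p = j
    · subst hpj
      rw [Function.update_self] at hu
      exact h c hc p hp u (hsub u hu)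
    · rw [Function.update_of_ne hpj] at hu
      exact h c hc p hp u hu

theorem IsReduced.project (h : IsReduced nodes parent A R) {i : ι} {Y : Finset α}
    {R' : List (Row α V S)} (hR' : IsProjection Y (R i) R')
    (hne : ∀ k ∈ nodes, parent k ≠ some k) :
    IsReduced nodes parent (Function.update A i (A i ∩ Y)) (Function.update R i R') := by
  intro c hc p hp u hu
  have hpc : p ≠ c := by
    rintro rfl
    exact hne p hc hp
  by_cases hci : c = i
  · subst hci
    rw [Function.update_of_ne hpc] at hu ⊢
    obtain ⟨v, hv, hvu⟩ := h c hc p hp u hu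
    rw [Function.update_self, Function.update_self]
    refine ⟨restrict Y v, (hR' _).2 ⟨v, hv, rfl⟩, fun a hap hac => ?_⟩
    obtain ⟨hac, haY⟩ := Finset.mem_inter.1 hac
    simpa [restrict, haY] using hvu a hap hac
  · rw [Function.update_of_ne hci, Function.update_of_ne hci]
    by_cases hpi : p = i
    · subst hpi
      rw [Function.update_self] at hu ⊢
      obtain ⟨w, hw, rfl⟩ := (hR' _).1 hu
      obtain ⟨v, hv, hvw⟩ := h c hc p hp w hw
      refine ⟨v, hv, fun a hap hac => ?_⟩
      obtain ⟨hap, haY⟩ := Finset.mem_inter.1 hap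
      simpa [restrict, haY] using hvw a hap hac
    · rw [Function.update_of_ne hpi] at hu ⊢
      exact h c hc p hp u hu

/-- Towards the old parent of `p`, a match at `p` is glued with a match of it at `c`. Towards a
child of `p` or of `c`, the restriction of the joined tuple to that node has a match, and
connectedness puts all attributes that the child shares with the merged node into that node. -/
theorem IsReduced.contract [Fintype α] [DecidableEq V] [MulZeroClass S]
    (h : IsReduced nodes parent A R) (hT : IsJoinTree nodes parent A root rank)
    (hw : ∀ k ∈ nodes, WellFormed (A k) (R k))
    {p c : ι} (hc : c ∈ nodes) (hp : parent c = some p)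
    {J : List (Row α V S)} (hJ : IsJoin (A p) (A c) (R p) (R c) J) :
    IsReduced (nodes.erase c) (contractParent parent p c) (Function.update A p (A p ∪ A c))
      (Function.update R p J) := by
  have hpm := hT.parent_mem c hc p hp
  have hpc := hT.ne_of_parent hc hp
  intro k hk q hq u hu
  obtain ⟨hkc, hk⟩ := Finset.mem_erase.1 hk
  by_cases hkp : k = p
  · subst hkp
    have hnk : parent k ≠ some c := by
      intro e
      have h1 := hT.rank_lt k hk c e
      have h2 := hT.rank_lt c hc k hp
      omega
    rw [contractParent, if_neg hnk] at hq
    have hqk := hT.ne_of_parent hk hq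
    rw [Function.update_of_ne hqk] at hu ⊢
    rw [Function.update_self, Function.update_self]
    obtain ⟨v, hv, hvu⟩ := h k hk q hq u hu
    obtain ⟨w, hw', hwv⟩ := h c hc k hp v hv
    have hvo := (hw k hk).isOver v hv
    have hwo := (hw c hc).isOver w hw'
    have hg1 : restrict (A k) (glue v w) = v := hvo.restrict_glue_left w
    have hg2 : restrict (A c) (glue v w) = w := hvo.restrict_glue_right hwo fun a ha =>
      (hwv a (Finset.mem_inter.1 ha).1 (Finset.mem_inter.1 ha).2).symm
    refine ⟨glue v w, (hJ.mem_iff _ (hvo.glue hwo)).2 ⟨hg1.symm ▸ hv, hg2.symm ▸ hw'⟩, ?_⟩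
    intro a haq hau
    have hak : a ∈ A k := by
      rcases Finset.mem_union.1 hau with ha | ha
      · exact ha
      · refine hT.mem_parent hc (hT.parent_mem k hk q hq) hp ha haq fun hb => ?_
        have h1 := hT.rank_le (hT.parent_mem k hk q hq) hb
        have h2 := hT.rank_lt k hk q hq
        have h3 := hT.rank_lt c hc k hp
        omega
    have := congrFun hg1 a
    rw [restrict, if_pos hak] at this
    rw [this]
    exact hvu a haq hak
  · rw [Function.update_of_ne hkp, Function.update_of_ne hkp]
    by_cases hqp : q = p
    · subst hqp
      rw [Function.update_self] at hu ⊢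
      have huo := hJ.wellFormed.isOver u hu
      obtain ⟨h1, h2⟩ := (hJ.mem_iff u huo).1 hu
      by_cases hkc' : parent k = some c
      · obtain ⟨v, hv, hvu⟩ := h k hk c hkc' _ h2
        refine ⟨v, hv, fun a haq hak => ?_⟩
        have hac : a ∈ A c := by
          rcases Finset.mem_union.1 haq with ha | ha
          · refine hT.mem_parent hk hpm hkc' hak ha fun hb => ?_
            have h1 := hT.rank_le hpm hb
            have h2 := hT.rank_lt k hk c hkc'
            have h3 := hT.rank_lt c hc q hp
            omega
          · exact ha
        simpa [restrict, hac] using hvu a hac hak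
      · rw [contractParent, if_neg hkc'] at hq
        obtain ⟨v, hv, hvu⟩ := h k hk q hq _ h1
        refine ⟨v, hv, fun a haq hak => ?_⟩
        have hac : a ∈ A q := by
          rcases Finset.mem_union.1 haq with ha | ha
          · exact ha
          · refine hT.mem_parent hk hc hq hak ha fun hb => ?_
            rcases hb.eq_or_parent with e | ⟨r, hr, hb⟩
            · exact hkc e.symm
            · rw [hp] at hr
              obtain rfl := Option.some.inj hr
              exact hT.not_below hk hq hb
        simpa [restrict, hac] using hvu a hac hak
    · have hkc' : parent k ≠ some c := by
        intro e
        rw [contractParent, if_pos e] at hq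
        exact hqp (Option.some.inj hq).symm
      rw [contractParent, if_neg hkc'] at hq
      rw [Function.update_of_ne hqp] at hu ⊢
      exact h k hk q hq u hu

theorem IsDanglingFree.project {k : ι} (h : IsDanglingFree nodes A R k) (hk : k ∈ nodes) {i : ι}
    (hi : i ∈ nodes) {Y : Finset α} {R' : List (Row α V S)} (hR' : IsProjection Y (R i) R') :
    IsDanglingFree nodes (Function.update A i (A i ∩ Y)) (Function.update R i R') k := by
  have hs := Finset.subset_biUnion_of_mem (Function.update A i (A i ∩ Y)) hk
  intro u hu
  by_cases hki : k = i
  · subst hki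
    rw [Function.update_self] at hu hs
    obtain ⟨v, hv, rfl⟩ := (hR' _).1 hu
    obtain ⟨t, ht, rfl⟩ := h v hv
    refine ⟨_, restrict_mem_fullJoin_project hi hR' ht, ?_⟩
    rw [Function.update_self, restrict_restrict_of_subset hs, restrict_restrict,
      Finset.inter_comm]
  · rw [Function.update_of_ne hki] at hu hs
    obtain ⟨t, ht, rfl⟩ := h u hu
    refine ⟨_, restrict_mem_fullJoin_project hi hR' ht, ?_⟩
    rw [Function.update_of_ne hki, restrict_restrict_of_subset hs]

/-- The join of a dangling-free relation with a child of it is dangling-free. -/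
theorem IsDanglingFree.join [Fintype α] [DecidableEq V] [MulZeroClass S]
    (hR : IsReduced nodes parent A R) (hT : IsJoinTree nodes parent A root rank)
    (hw : ∀ k ∈ nodes, WellFormed (A k) (R k))
    {p c : ι} (hc : c ∈ nodes) (hp : parent c = some p) (hd : IsDanglingFree nodes A R p)
    {J : List (Row α V S)} (hJ : IsJoin (A p) (A c) (R p) (R c) J) :
    ∀ u ∈ tuples J, ∃ t ∈ fullJoin nodes A R, restrict (A p ∪ A c) t = u := by
  intro u hu
  have huo := hJ.wellFormed.isOver u hu
  obtain ⟨h1, h2⟩ := (hJ.mem_iff u huo).1 hu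
  obtain ⟨t, ht, htu⟩ := hd _ h1
  obtain ⟨t', ht', e1, e2⟩ := hR.exists_extension hT hw hc hp ht h2 fun a hap hac => by
    have := congrFun htu a
    simp only [restrict, hap, if_true] at this
    simp [restrict, hac, this]
  refine ⟨t', ht', ?_⟩
  rw [← huo.restrict_self, restrict_eq_iff]
  intro a ha
  rcases Finset.mem_union.1 ha with ha | ha
  · exact restrict_eq_iff.1 (e1.trans htu) a ha
  · exact restrict_eq_iff.1 e2 a ha

/-- The semi-join of a relation with a dangling-free parent is dangling-free. -/
theorem IsDanglingFree.semijoin (hR : IsReduced nodes parent A R)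
    (hT : IsJoinTree nodes parent A root rank) (hw : ∀ k ∈ nodes, WellFormed (A k) (R k))
    {p c : ι} (hc : c ∈ nodes) (hp : parent c = some p) (hd : IsDanglingFree nodes A R p)
    {v : Tuple α V} (hv : v ∈ tuples (R c))
    (hm : ∃ u ∈ tuples (R p), ∀ a ∈ A p, a ∈ A c → u a = v a) :
    ∃ t ∈ fullJoin nodes A R, restrict (A c) t = v := by
  obtain ⟨u, hu, huv⟩ := hm
  obtain ⟨t, ht, rfl⟩ := hd u hu
  obtain ⟨t', ht', -, e2⟩ := hR.exists_extension hT hw hc hp ht hv fun a hap hac => by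
    simpa [restrict, hap] using (huv a hap hac).symm
  exact ⟨t', ht', e2⟩

/-! ### Size bounds -/

/-- Up to output attributes, the relation `R` over `X` has at most `n` tuples. -/
def HasCore [Fintype α] [DecidableEq V] (O : Finset α) (n : ℕ) (X : Finset α)
    (R : List (Row α V S)) : Prop :=
  ∃ Z ⊆ X, X ⊆ O ∪ Z ∧ ((tuples R).toFinset.image (restrict Z)).card ≤ n

variable [Fintype α] [DecidableEq V] {O : Finset α} {n : ℕ} {X : Finset α}

theorem HasCore.of_length_le {R : List (Row α V S)} (h : R.length ≤ n) : HasCore O n X R := by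
  refine ⟨X, Finset.Subset.refl _, Finset.subset_union_right, Finset.card_image_le.trans ?_⟩
  refine (List.toFinset_card_le _).trans ?_
  rwa [tuples, List.length_map]

theorem HasCore.mono {R R' : List (Row α V S)} (h : HasCore O n X R)
    (hsub : ∀ t ∈ tuples R', t ∈ tuples R) : HasCore O n X R' := by
  obtain ⟨Z, h1, h2, h3⟩ := h
  refine ⟨Z, h1, h2, (Finset.card_le_card (Finset.image_subset_image fun t ht => ?_)).trans h3⟩
  rw [List.mem_toFinset] at ht ⊢
  exact hsub t ht

theorem HasCore.project {R R' : List (Row α V S)} (h : HasCore O n X R) {Y : Finset α}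
    (hR' : IsProjection Y R R') : HasCore O n (X ∩ Y) R' := by
  obtain ⟨Z, h1, h2, h3⟩ := h
  refine ⟨Z ∩ Y, Finset.inter_subset_inter_right h1, ?_, ?_⟩
  · intro a ha
    obtain ⟨haX, haY⟩ := Finset.mem_inter.1 ha
    have := h2 haX
    simp only [Finset.mem_union, Finset.mem_inter] at this ⊢
    tauto
  · have : (tuples R').toFinset.image (restrict (Z ∩ Y)) ⊆
        ((tuples R).toFinset.image (restrict Z)).image (restrict Y) := by
      intro t ht
      obtain ⟨u, hu, rfl⟩ := Finset.mem_image.1 ht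
      obtain ⟨v, hv, rfl⟩ := (hR' u).1 (List.mem_toFinset.1 hu)
      refine Finset.mem_image.2 ⟨restrict Z v,
        Finset.mem_image_of_mem _ (List.mem_toFinset.2 hv), ?_⟩
      rw [restrict_restrict, restrict_restrict, Finset.inter_assoc, Finset.inter_self,
        Finset.inter_comm]
    exact (Finset.card_le_card this).trans (Finset.card_image_le.trans h3)

/-- A core of `Q` remains a core of the join, because `P` contributes only output attributes beyond
those of `Q`. -/
theorem HasCore.join [MulZeroClass S] {X' : Finset α} {P Q J : List (Row α V S)}
    (h : HasCore O n X' Q) (hJ : IsJoin X X' P Q J) (hX : X ⊆ O ∪ X') :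
    HasCore O n (X ∪ X') J := by
  obtain ⟨Z, h1, h2, h3⟩ := h
  refine ⟨Z, h1.trans Finset.subset_union_right, ?_, ?_⟩
  · intro a ha
    simp only [Finset.mem_union] at ha ⊢
    rcases ha with ha | ha
    · rcases Finset.mem_union.1 (hX ha) with ha | ha
      · exact Or.inl ha
      · exact Finset.mem_union.1 (h2 ha)
    · exact Finset.mem_union.1 (h2 ha)
  · refine (Finset.card_le_card ?_).trans h3
    intro t ht
    obtain ⟨u, hu, rfl⟩ := Finset.mem_image.1 ht
    have hu := List.mem_toFinset.1 hu
    have h4 := ((hJ.mem_iff u (hJ.wellFormed.isOver u hu)).1 hu).2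
    rw [← restrict_restrict_of_subset h1]
    exact Finset.mem_image_of_mem _ (List.mem_toFinset.2 h4)

/-- A tuple is determined by its restriction to the core and the output part of a chosen extension
in `F`; the pairs of these two are counted. -/
theorem HasCore.length_le {R : List (Row α V S)} (h : HasCore O n X R) (hw : WellFormed X R)
    {F : Finset (Tuple α V)} (hF : ∀ u ∈ tuples R, ∃ t ∈ F, restrict X t = u) :
    R.length ≤ n * (F.image (restrict O)).card := by
  obtain ⟨Z, h1, h2, h3⟩ := h
  choose! f hf1 hf2 using hF
  have hlen : R.length = (tuples R).toFinset.card := by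
    rw [List.toFinset_card_of_nodup hw.nodup, tuples, List.length_map]
  rw [hlen]
  refine le_trans ?_ (Nat.mul_le_mul_right _ h3)
  rw [← Finset.card_product]
  refine Finset.card_le_card_of_injOn (fun u => (restrict Z u, restrict O (f u))) ?_ ?_
  · intro u hu
    have hu' := List.mem_toFinset.1 hu
    exact Finset.mem_product.2 ⟨Finset.mem_image_of_mem _ hu,
      Finset.mem_image_of_mem _ (hf1 u hu')⟩
  · intro u hu v hv e
    have hu := List.mem_toFinset.1 hu
    have hv := List.mem_toFinset.1 hv
    obtain ⟨e1, e2⟩ := Prod.mk.inj e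
    refine (hw.isOver u hu).ext (hw.isOver v hv) fun a ha => ?_
    rcases Finset.mem_union.1 (h2 ha) with haO | haZ
    · have e3 := restrict_eq_iff.1 e2 a haO
      have e4 := congrFun (hf2 u hu) a
      have e5 := congrFun (hf2 v hv) a
      simp only [restrict, ha, if_true] at e4 e5
      rw [← e4, ← e5, e3]
    · exact restrict_eq_iff.1 e1 a haZ

theorem length_le_card {R : List (Row α V S)} (hw : WellFormed X R)
    {F : Finset (Tuple α V)} (hF : ∀ u ∈ tuples R, ∃ t ∈ F, restrict X t = u) :
    R.length ≤ F.card := by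
  refine (hw.length_le (F := F.image (restrict X)) fun u hu => ?_).trans Finset.card_image_le
  exact Finset.mem_image.2 (hF u hu)

end transformations

/-! ### Relations that represent the query result -/

section represents

variable {α : Type uA} {ι : Type uI} {V : Type uV} {S : Type uS} [Fintype α] [DecidableEq α]
  [DecidableEq ι] [DecidableEq V]

/-- The full join of listed relations, as a finite set of tuples. -/
noncomputable def finiteJoin (nodes : Finset ι) (A : ι → Finset α) (R : ι → List (Row α V S)) :
    Finset (Tuple α V) :=
  (fullJoin_finite nodes A R).toFinset

theorem mem_finiteJoin {nodes : Finset ι} {A : ι → Finset α} {R : ι → List (Row α V S)}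
    {t : Tuple α V} : t ∈ finiteJoin nodes A R ↔ t ∈ fullJoin nodes A R := by
  simp [finiteJoin]

theorem finiteJoin_eq {nodes nodes' : Finset ι} {A A' : ι → Finset α}
    {R R' : ι → List (Row α V S)} (h : fullJoin nodes A R = fullJoin nodes' A' R') :
    finiteJoin nodes A R = finiteJoin nodes' A' R' := by
  ext t
  rw [mem_finiteJoin, mem_finiteJoin, h]

/-- The product of the annotations of the constituents of a tuple in the full join. -/
def weight [CommSemiring S] (nodes : Finset ι) (A : ι → Finset α) (R : ι → List (Row α V S))
    (t : Tuple α V) : S :=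
  ∏ i ∈ nodes, Instance.annot (R i) (restrict (A i) t)

/-- The query with output attributes `O` on the listed relations has the result tuples `out`, with
the annotations `ann`, and its full join has at most `F` tuples. -/
structure Represents [CommSemiring S] (O : Finset α) (out : Finset (Tuple α V))
    (ann : Tuple α V → S) (F : ℕ) (nodes : Finset ι) (A : ι → Finset α)
    (R : ι → List (Row α V S)) : Prop where
  wellFormed : ∀ k ∈ nodes, WellFormed (A k) (R k)
  out_subset : O ⊆ nodes.biUnion A
  image_eq : (finiteJoin nodes A R).image (restrict O) = out
  card_le : (finiteJoin nodes A R).card ≤ F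
  sum_eq : ∀ u, ∑ t ∈ finiteJoin nodes A R with restrict O t = u, weight nodes A R t = ann u

variable [CommSemiring S] {O : Finset α} {out : Finset (Tuple α V)} {ann : Tuple α V → S} {F : ℕ}
  {nodes : Finset ι} {A : ι → Finset α} {R : ι → List (Row α V S)}

/-- Filtering and joining leave the full join as a set unchanged, so only the weights have to be
compared, tuple by tuple. -/
theorem Represents.of_fullJoin_eq (h : Represents O out ann F nodes A R) {nodes' : Finset ι}
    {A' : ι → Finset α} {R' : ι → List (Row α V S)}
    (hw : ∀ k ∈ nodes', WellFormed (A' k) (R' k)) (hU : nodes'.biUnion A' = nodes.biUnion A)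
    (hj : fullJoin nodes' A' R' = fullJoin nodes A R)
    (hwt : ∀ t ∈ fullJoin nodes A R, weight nodes' A' R' t = weight nodes A R t) :
    Represents O out ann F nodes' A' R' where
  wellFormed := hw
  out_subset := hU ▸ h.out_subset
  image_eq := by rw [finiteJoin_eq hj]; exact h.image_eq
  card_le := by rw [finiteJoin_eq hj]; exact h.card_le
  sum_eq u := by
    rw [finiteJoin_eq hj, ← h.sum_eq u]
    exact Finset.sum_congr rfl fun t ht => hwt t (mem_finiteJoin.1 (Finset.mem_filter.1 ht).1)

theorem Represents.congr (h : Represents O out ann F nodes A R) {A' : ι → Finset α}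
    {R' : ι → List (Row α V S)} (hA : ∀ k ∈ nodes, A' k = A k) (hR : ∀ k ∈ nodes, R' k = R k) :
    Represents O out ann F nodes A' R' := by
  refine h.of_fullJoin_eq (fun k hk => ?_) (Finset.biUnion_congr rfl hA) (fullJoin_congr hA hR)
    fun t _ => Finset.prod_congr rfl fun k hk => ?_
  · rw [hA k hk, hR k hk]
    exact h.wellFormed k hk
  · rw [hA k hk, hR k hk]

theorem Represents.filter (h : Represents O out ann F nodes A R) {j : ι}
    {R' : List (Row α V S)} (hw : WellFormed (A j) R')
    (hsub : ∀ t ∈ tuples R', t ∈ tuples (R j))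
    (hkeep : ∀ t ∈ fullJoin nodes A R, restrict (A j) t ∈ tuples R')
    (hann : ∀ t ∈ tuples R', Instance.annot R' t = Instance.annot (R j) t) :
    Represents O out ann F nodes A (Function.update R j R') := by
  refine h.of_fullJoin_eq (fun k hk => ?_) rfl (fullJoin_filter hsub hkeep)
    fun t ht => Finset.prod_congr rfl fun k hk => ?_
  · by_cases hkj : k = j
    · subst hkj
      rwa [Function.update_self]
    · rw [Function.update_of_ne hkj]
      exact h.wellFormed k hk
  · by_cases hkj : k = j
    · subst hkj
      rw [Function.update_self, hann _ (hkeep t ht)]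
    · rw [Function.update_of_ne hkj]

theorem Represents.join (h : Represents O out ann F nodes A R) {p c : ι} (hp : p ∈ nodes)
    (hc : c ∈ nodes) (hpc : p ≠ c) {J : List (Row α V S)}
    (hJ : IsJoin (A p) (A c) (R p) (R c) J) :
    Represents O out ann F (nodes.erase c) (Function.update A p (A p ∪ A c))
      (Function.update R p J) := by
  refine h.of_fullJoin_eq (fun k hk => ?_) (biUnion_join hp hc hpc) (fullJoin_join hp hc hpc hJ)
    fun t ht => ?_
  · by_cases hkp : k = p
    · subst hkp
      rw [Function.update_self, Function.update_self]
      exact hJ.wellFormed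
    · rw [Function.update_of_ne hkp, Function.update_of_ne hkp]
      exact h.wellFormed k (Finset.mem_of_mem_erase hk)
  · obtain ⟨hto, htm⟩ := mem_fullJoin.1 ht
    have hU : A p ∪ A c ⊆ nodes.biUnion A :=
      Finset.union_subset (Finset.subset_biUnion_of_mem A hp) (Finset.subset_biUnion_of_mem A hc)
    have hpe : p ∈ nodes.erase c := Finset.mem_erase.2 ⟨hpc, hp⟩
    unfold weight
    rw [← Finset.mul_prod_erase _ _ hc, ← Finset.mul_prod_erase _ _ hpe,
      ← Finset.mul_prod_erase _ _ hpe, Function.update_self, Function.update_self,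
      hJ.annot _ ((hJ.mem_iff' hto hU).2 ⟨htm p hp, htm c hc⟩),
      restrict_restrict_of_subset Finset.subset_union_left,
      restrict_restrict_of_subset Finset.subset_union_right, ← mul_assoc, mul_comm
        (Instance.annot (R p) _)]
    congr 1
    refine Finset.prod_congr rfl fun k hk => ?_
    have hkp := (Finset.mem_erase.1 hk).1
    rw [Function.update_of_ne hkp, Function.update_of_ne hkp]

/-- The new full join is the image of the old one under restriction. The old tuples over `t` are
`glue v t`, for the tuples `v` of `R i` with the prescribed projection. Their weights differ only in
the factor of relation `i`, so distributivity turns their sum into the weight of `t`. -/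
theorem Represents.project (h : Represents O out ann F nodes A R) {i : ι} (hi : i ∈ nodes)
    {Y : Finset α} (hO : ∀ a ∈ A i, a ∉ Y → a ∉ O)
    (hY : ∀ a ∈ A i, a ∉ Y → ∀ k ∈ nodes, k ≠ i → a ∉ A k) :
    Represents O out ann F nodes (Function.update A i (A i ∩ Y))
      (Function.update R i (project Y (R i)).val) := by
  have hw := h.wellFormed i hi
  have hR' : IsProjection Y (R i) (YannakakisPlus.project Y (R i)).val := fun t => mem_tuples_project
  have hmaps : ∀ t ∈ finiteJoin nodes A R,
      restrict (nodes.biUnion (Function.update A i (A i ∩ Y))) t ∈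
        finiteJoin nodes (Function.update A i (A i ∩ Y))
          (Function.update R i (YannakakisPlus.project Y (R i)).val) := fun t ht =>
    mem_finiteJoin.2 (restrict_mem_fullJoin_project hi hR' (mem_finiteJoin.1 ht))
  have hOU : O ⊆ nodes.biUnion (Function.update A i (A i ∩ Y)) := by
    intro a ha
    obtain ⟨k, hk, hak⟩ := Finset.mem_biUnion.1 (h.out_subset ha)
    refine Finset.mem_biUnion.2 ⟨k, hk, ?_⟩
    by_cases hki : k = i
    · subst hki
      rw [Function.update_self]
      refine Finset.mem_inter.2 ⟨hak, ?_⟩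
      by_contra haY
      exact hO a hak haY ha
    · rwa [Function.update_of_ne hki]
  have himg : finiteJoin nodes (Function.update A i (A i ∩ Y))
      (Function.update R i (YannakakisPlus.project Y (R i)).val) = (finiteJoin nodes A R).image
        (restrict (nodes.biUnion (Function.update A i (A i ∩ Y)))) := by
    ext t
    constructor
    · intro ht
      have ht := mem_finiteJoin.1 ht
      obtain ⟨v, hv, hvt⟩ := exists_glue hi hR' ht
      obtain ⟨h1, h2, -⟩ := glue_mem_fullJoin hi hw hY ht hv hvt
      exact Finset.mem_image.2 ⟨_, mem_finiteJoin.2 h1, h2⟩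
    · intro ht
      obtain ⟨u, hu, rfl⟩ := Finset.mem_image.1 ht
      exact hmaps u hu
  refine ⟨fun k hk => ?_, hOU, ?_, ?_, fun u => ?_⟩
  · by_cases hki : k = i
    · subst hki
      rw [Function.update_self, Function.update_self]
      exact hw.project Y
    · rw [Function.update_of_ne hki, Function.update_of_ne hki]
      exact h.wellFormed k hk
  · rw [himg, Finset.image_image, ← h.image_eq]
    refine Finset.image_congr fun t _ => ?_
    exact restrict_restrict_of_subset hOU t
  · rw [himg]
    exact Finset.card_image_le.trans h.card_le
  · rw [← h.sum_eq u, ← Finset.sum_fiberwise_of_maps_to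
      (s := (finiteJoin nodes A R).filter fun t => restrict O t = u)
      (t := (finiteJoin nodes (Function.update A i (A i ∩ Y))
        (Function.update R i (YannakakisPlus.project Y (R i)).val)).filter fun t => restrict O t = u)
      (g := restrict (nodes.biUnion (Function.update A i (A i ∩ Y)))) ?_ (weight nodes A R)]
    · refine Finset.sum_congr rfl fun t ht => ?_
      obtain ⟨ht, htO⟩ := Finset.mem_filter.1 ht
      have ht := mem_finiteJoin.1 ht
      have hrest : ∀ k ∈ nodes.erase i, ∀ x,
          restrict (nodes.biUnion (Function.update A i (A i ∩ Y))) x = t →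
          restrict (A k) x = restrict (A k) t := by
        intro k hk x hx
        obtain ⟨hki, hk⟩ := Finset.mem_erase.1 hk
        have hs := Finset.subset_biUnion_of_mem (Function.update A i (A i ∩ Y)) hk
        rw [Function.update_of_ne hki] at hs
        rw [← hx, restrict_restrict_of_subset hs]
      have hL : weight nodes (Function.update A i (A i ∩ Y))
          (Function.update R i (YannakakisPlus.project Y (R i)).val) t =
          (∑ v ∈ (tuples (R i)).toFinset with restrict Y v = restrict (A i ∩ Y) t,
            Instance.annot (R i) v) *
          ∏ k ∈ nodes.erase i, Instance.annot (R k) (restrict (A k) t) := by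
        rw [weight, ← Finset.mul_prod_erase _ _ hi, Function.update_self, Function.update_self,
          annot_project hw]
        congr 1
        refine Finset.prod_congr rfl fun k hk => ?_
        have hki := (Finset.mem_erase.1 hk).1
        rw [Function.update_of_ne hki, Function.update_of_ne hki]
      rw [hL, Finset.sum_mul]
      refine Finset.sum_bij' (fun v _ => glue v t) (fun x _ => restrict (A i) x) ?_ ?_ ?_ ?_ ?_
      · intro v hv
        obtain ⟨hv, hvt⟩ := Finset.mem_filter.1 hv
        obtain ⟨h1, h2, -⟩ := glue_mem_fullJoin hi hw hY ht (List.mem_toFinset.1 hv) hvt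
        refine Finset.mem_filter.2 ⟨Finset.mem_filter.2 ⟨mem_finiteJoin.2 h1, ?_⟩, h2⟩
        rw [← restrict_restrict_of_subset hOU, h2, htO]
      · intro x hx
        obtain ⟨hx, hxt⟩ := Finset.mem_filter.1 hx
        obtain ⟨hx, -⟩ := Finset.mem_filter.1 hx
        refine Finset.mem_filter.2 ⟨List.mem_toFinset.2
          ((mem_fullJoin.1 (mem_finiteJoin.1 hx)).2 i hi), ?_⟩
        have hs := Finset.subset_biUnion_of_mem (Function.update A i (A i ∩ Y)) hi
        rw [Function.update_self] at hs
        rw [← hxt, restrict_restrict_of_subset hs, restrict_restrict, Finset.inter_comm]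
      · intro v hv
        obtain ⟨hv, hvt⟩ := Finset.mem_filter.1 hv
        exact (glue_mem_fullJoin hi hw hY ht (List.mem_toFinset.1 hv) hvt).2.2
      · intro x hx
        obtain ⟨hx, hxt⟩ := Finset.mem_filter.1 hx
        obtain ⟨hx, -⟩ := Finset.mem_filter.1 hx
        obtain ⟨hxo, hxm⟩ := mem_fullJoin.1 (mem_finiteJoin.1 hx)
        have hs := Finset.subset_biUnion_of_mem (Function.update A i (A i ∩ Y)) hi
        rw [Function.update_self] at hs
        obtain ⟨h1, h2, h3⟩ := glue_mem_fullJoin hi hw hY ht (hxm i hi) (by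
          rw [← hxt, restrict_restrict_of_subset hs, restrict_restrict, Finset.inter_comm])
        refine (mem_fullJoin.1 h1).1.ext hxo fun a ha => ?_
        obtain ⟨k, hk, hak⟩ := Finset.mem_biUnion.1 ha
        by_cases hki : k = i
        · subst hki
          exact restrict_eq_iff.1 h3 a hak
        · have hke := Finset.mem_erase.2 ⟨hki, hk⟩
          exact restrict_eq_iff.1 ((hrest k hke _ h2).trans (hrest k hke x hxt).symm) a hak
      · intro v hv
        obtain ⟨hv, hvt⟩ := Finset.mem_filter.1 hv
        obtain ⟨-, h2, h3⟩ := glue_mem_fullJoin hi hw hY ht (List.mem_toFinset.1 hv) hvt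
        rw [weight, ← Finset.mul_prod_erase _ _ hi, h3]
        congr 1
        exact Finset.prod_congr rfl fun k hk => by rw [hrest k hk _ h2]
    · intro t ht
      obtain ⟨ht, htO⟩ := Finset.mem_filter.1 ht
      refine Finset.mem_filter.2 ⟨hmaps t ht, ?_⟩
      rw [restrict_restrict_of_subset hOU, htO]

end represents

/-! ### The first round -/

section initial

variable {α : Type uA} {ι : Type uI} [DecidableEq α] [Fintype ι] [DecidableEq ι] {Q : CQ α ι}

/-- The rank is the distance to the root, found by iterating the parent map on `Option ι`. -/
theorem JoinTree.exists_rank (T : JoinTree Q) : ∃ rank : ι → ℕ,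
    IsRootedTree Finset.univ T.parent T.root rank := by
  have hr : T.parent T.root = none := (T.parent_eq_none _).2 rfl
  let up : Option ι → Option ι := fun o => o.bind T.parent
  have hex : ∀ i, ∃ n, up^[n] (some i) = some T.root := by
    intro i
    induction T.reaches_root i using Relation.ReflTransGen.head_induction_on with
    | refl => exact ⟨0, rfl⟩
    | head h _ ih =>
      obtain ⟨n, hn⟩ := ih
      refine ⟨n + 1, ?_⟩
      rw [Function.iterate_succ_apply]
      simpa [up, h] using hn
  refine ⟨fun i => Nat.find (hex i), Finset.mem_univ _, hr, ?_, fun _ _ _ _ => Finset.mem_univ _,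
    ?_⟩
  · intro i _ hi
    exact Option.ne_none_iff_exists'.1 (mt (T.parent_eq_none i).1 hi)
  · intro i _ p hp
    have h1 := Nat.find_spec (hex i)
    have h2 : Nat.find (hex i) ≠ 0 := by
      intro h0
      rw [h0] at h1
      have : i = T.root := Option.some.inj h1
      rw [this, hr] at hp
      cases hp
    obtain ⟨n, hn⟩ := Nat.exists_eq_succ_of_ne_zero h2
    rw [hn, Nat.succ_eq_add_one, Function.iterate_succ_apply] at h1
    have h3 : up (some i) = some p := hp
    rw [h3] at h1
    have := Nat.find_min' (hex p) h1
    omega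

/-- A path through nodes with `a` that starts at a topmost one cannot leave its subtree, since it
would have to pass through the parent, which lacks `a`. So two topmost nodes lie below each other
and are equal. -/
theorem JoinTree.isJoinTree (T : JoinTree Q) {rank : ι → ℕ}
    (h : IsRootedTree Finset.univ T.parent T.root rank) :
    IsJoinTree Finset.univ T.parent Q.attrs T.root rank := by
  refine ⟨h, ?_⟩
  have key : ∀ a k l, IsTop Finset.univ T.parent Q.attrs a k → a ∈ Q.attrs l →
      IsBelow T.parent l k := by
    rintro a k l ⟨-, hk, hkt⟩ hl
    have hreach := T.connected a ⟨k, hk⟩ ⟨l, hl⟩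
    rw [SimpleGraph.reachable_iff_reflTransGen] at hreach
    suffices ∀ y : {i | a ∈ Q.attrs i}, Relation.ReflTransGen
        ((SimpleGraph.fromRel (fun j k => T.parent j = some k)).induce {i | a ∈ Q.attrs i}).Adj
        ⟨k, hk⟩ y → IsBelow T.parent y.1 k from this _ hreach
    intro y hy
    induction hy with
    | refl => exact .refl
    | @tail b c _ hbc ih =>
      rw [SimpleGraph.comap_adj, SimpleGraph.fromRel_adj] at hbc
      rcases hbc.2 with h1 | h1
      · rcases ih.eq_or_parent with e | ⟨p, hp, hb⟩
        · exact absurd c.2 (hkt _ (e ▸ h1))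
        · have : (some p : Option ι) = some c.1 := hp.symm.trans h1
          exact Option.some.inj this ▸ hb
      · exact .head h1 ih
  intro a k l hk hl
  rcases (key a k l hk hl.2.1).eq_or_parent with e | ⟨p, hp, hb⟩
  · exact e.symm
  · exact absurd (key a l k hl hk.2.1) fun hkl => by
      have h1 := h.rank_le (Finset.mem_univ _) hb
      have h2 := h.rank_le (Finset.mem_univ _) hkl
      have h3 := h.rank_lt l (Finset.mem_univ _) p hp
      omega

/-! ### The test instance with an empty root relation -/

/-- The tuple over `X` with all values equal to `v`. -/
def constTuple {V : Type uV} (X : Finset α) (v : V) : Tuple α V :=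
  fun a => if a ∈ X then some v else none

theorem restrict_constTuple {V : Type uV} (X Y : Finset α) (v : V) :
    restrict Y (constTuple X v) = constTuple (X ∩ Y) v := by
  funext a
  by_cases hX : a ∈ X <;> by_cases hY : a ∈ Y <;> simp [restrict, constTuple, hX, hY]

theorem isOver_constTuple {V : Type uV} (X : Finset α) (v : V) : IsOver X (constTuple X v) := by
  intro a
  by_cases hX : a ∈ X <;> simp [constTuple, hX]

/-- The instance in which the root relation is empty and all the others consist of one tuple with
constant values. -/
def JoinTree.rootlessInstance (T : JoinTree Q) {V : Type uV} (S : Type uS) [One S] (v : V) :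
    Instance Q V S where
  rows i := if i = T.root then [] else [(constTuple (Q.attrs i) v, 1)]
  isSome_iff i r hr a := by
    split_ifs at hr
    · simp at hr
    · rw [List.mem_singleton.1 hr]
      exact isOver_constTuple _ _ a
  nodup i := by split_ifs <;> simp [tuples]

/-- The constant tuples match each other and survive the first round in all remaining non-root
relations, but none of them extends to the empty root. This instance therefore refutes
dangling-freeness of all these relations after the first round. -/
theorem JoinTree.output_rootlessInstance [Fintype α] (T : JoinTree Q) {V : Type uV} {S : Type uS}
    [DecidableEq V] [One S] (v : V) : (T.rootlessInstance S v).output = ∅ := by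
  rw [Instance.output, Finset.image_eq_empty, Finset.eq_empty_iff_forall_notMem]
  intro t ht
  have := (mem_fullJoin.1 ((Set.Finite.mem_toFinset _).1 ht)).2 T.root (Finset.mem_univ _)
  simp [JoinTree.rootlessInstance, tuples] at this

end initial

/-! ### The invariant of the first round -/

section firstRound

variable {α : Type uA} {ι : Type uI} {V : Type uV} {S : Type uS}
  [Fintype α] [DecidableEq α] [Fintype ι] [DecidableEq ι] [DecidableEq V] [CommSemiring S]
  {Q : CQ α ι}

theorem Instance.wellFormed (D : Instance Q V S) (i : ι) : WellFormed (Q.attrs i) (D.rows i) where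
  isOver t ht := by
    obtain ⟨r, hr, rfl⟩ := mem_tuples.1 ht
    exact D.isSome_iff i r hr
  nodup := D.nodup i

theorem Instance.represents (D : Instance Q V S) :
    Represents Q.out D.output D.outputAnnot D.joinSize Finset.univ Q.attrs D.rows where
  wellFormed k _ := D.wellFormed k
  out_subset := Q.out_subset
  image_eq := rfl
  card_le := le_refl _
  sum_eq _ := rfl

theorem Instance.length_rows_le (D : Instance Q V S) (i : ι) :
    (D.rows i).length ≤ D.inputSize :=
  Finset.single_le_sum (f := fun i => (D.rows i).length) (fun _ _ => Nat.zero_le _)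
    (Finset.mem_univ i)

/-- The invariant of the first round: the relations in `W` have been aggregated, those in `W'` have
been used to reduce their parents, and at most `b * N` steps were made. -/
structure FirstRoundInv (T : JoinTree Q) (rank : ι → ℕ) (v : V) (W W' : Finset ι) (b : ℕ)
    (s : State Q V S) : Prop where
  parent_eq : s.parent = T.parent
  tree : IsJoinTree s.nodes s.parent s.attrs T.root rank
  mem : ∀ i ∉ W, i ∈ s.nodes
  shared : ∀ i ∈ s.nodes, i ∈ W → ∀ a ∈ s.attrs i, a ∉ Q.out →
    ∃ k ∈ s.nodes, k ≠ i ∧ a ∈ s.attrs k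
  represents : ∀ D, Represents Q.out D.output D.outputAnnot D.joinSize s.nodes s.attrs (s.rows D)
  reduced : ∀ D, IsReduced (s.nodes ∩ W') s.parent s.attrs (s.rows D)
  const_mem : ∀ k ∈ s.nodes, k ≠ T.root →
    constTuple (s.attrs k) v ∈ tuples (s.rows (T.rootlessInstance S v) k)
  length_le : ∀ D, ∀ k ∈ s.nodes, (s.rows D k).length ≤ D.inputSize
  steps_le : ∀ D, s.steps D ≤ b * D.inputSize

variable {T : JoinTree Q} {rank : ι → ℕ} {v : V} {W W' : Finset ι} {b : ℕ} {s : State Q V S}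

theorem FirstRoundInv.start (h : IsRootedTree Finset.univ T.parent T.root rank) (v : V) :
    FirstRoundInv T rank v ∅ ∅ 0 (State.start Q V S T) where
  parent_eq := rfl
  tree := T.isJoinTree h
  mem _ _ := Finset.mem_univ _
  shared i _ hi := absurd hi (Finset.notMem_empty i)
  represents D := D.represents
  reduced D c hc := by simp at hc
  const_mem k _ hk := by
    change _ ∈ tuples ((T.rootlessInstance S v).rows k)
    simp only [JoinTree.rootlessInstance, if_neg hk, tuples, List.map_cons, List.mem_cons]
    exact Or.inl rfl
  length_le D k _ := D.length_rows_le k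
  steps_le D := by simp [State.start]

theorem State.mem_otherAttrs {s : State Q V S} {I : Finset ι} {a : α} :
    a ∈ s.otherAttrs I ↔ ∃ k ∈ s.nodes, k ∉ I ∧ a ∈ s.attrs k := by
  simp [State.otherAttrs, and_assoc]

theorem FirstRoundInv.parent_ne_self (h : FirstRoundInv T rank v W W' b s) :
    ∀ k ∈ s.nodes, s.parent k ≠ some k := fun _ hk e => h.tree.ne_of_parent hk e rfl

/-- A non-output attribute kept at `i` occurs elsewhere by the choice of the projection. An
attribute dropped at `i` occurs nowhere else, so no other relation loses its witness for `shared`.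
-/
theorem FirstRoundInv.aggregate (h : FirstRoundInv T rank v W W' b s) {i : ι}
    (hi : i ∈ s.nodes) :
    FirstRoundInv T rank v (insert i W) W' (b + 2) (s.aggregate i) := by
  have hO : ∀ a ∈ s.attrs i, a ∉ Q.out ∪ s.otherAttrs {i} → a ∉ Q.out := fun a _ ha ha' =>
    ha (Finset.mem_union_left _ ha')
  have hY : ∀ a ∈ s.attrs i, a ∉ Q.out ∪ s.otherAttrs {i} → ∀ k ∈ s.nodes, k ≠ i →
      a ∉ s.attrs k := fun a _ ha k hk hki hak => ha (Finset.mem_union_right _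
        (State.mem_otherAttrs.2 ⟨k, hk, by simpa using hki, hak⟩))
  have hattrs : (s.aggregate i).attrs = Function.update s.attrs i
    (s.attrs i ∩ (Q.out ∪ s.otherAttrs {i})) := rfl
  have hrows : ∀ D, (s.aggregate i).rows D = Function.update (s.rows D) i
    (project (Q.out ∪ s.otherAttrs {i}) (s.rows D i)).val := fun _ => rfl
  refine ⟨h.parent_eq, h.tree.project hY, fun k hk => h.mem k fun hkW =>
    hk (Finset.mem_insert_of_mem hkW), ?_, fun D => (h.represents D).project hi hO hY,
    fun D => ?_, ?_, fun D k hk => ?_, fun D => ?_⟩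
  · intro k hk hkW a ha haO
    change k ∈ s.nodes at hk
    change ∃ l ∈ s.nodes, _
    rw [hattrs] at ha ⊢
    by_cases hki : k = i
    · subst hki
      rw [Function.update_self] at ha
      obtain ⟨-, ha⟩ := Finset.mem_inter.1 ha
      obtain ⟨l, hl, hlk, hal⟩ := State.mem_otherAttrs.1 ((Finset.mem_union.1 ha).resolve_left haO)
      rw [Finset.mem_singleton] at hlk
      exact ⟨l, hl, hlk, by rwa [Function.update_of_ne hlk]⟩
    · rw [Function.update_of_ne hki] at ha
      obtain ⟨l, hl, hlk, hal⟩ := h.shared k hk ((Finset.mem_insert.1 hkW).resolve_left hki) a ha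
        haO
      refine ⟨l, hl, hlk, ?_⟩
      by_cases hli : l = i
      · subst hli
        rw [Function.update_self]
        by_contra hc
        exact hY a hal (fun hc' => hc (Finset.mem_inter.2 ⟨hal, hc'⟩)) k hk hki ha
      · rwa [Function.update_of_ne hli]
  · exact (h.reduced D).project (fun t => mem_tuples_project) fun k hk =>
      h.parent_ne_self k (Finset.mem_inter.1 hk).1
  · intro k hk hkr
    rw [hattrs, hrows]
    by_cases hki : k = i
    · subst hki
      rw [Function.update_self, Function.update_self, mem_tuples_project]
      exact ⟨_, h.const_mem k hk hkr, restrict_constTuple _ _ _⟩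
    · rw [Function.update_of_ne hki, Function.update_of_ne hki]
      exact h.const_mem k hk hkr
  · rw [hrows]
    by_cases hki : k = i
    · subst hki
      rw [Function.update_self]
      exact (project_length_le _ _).trans (h.length_le D k hk)
    · rw [Function.update_of_ne hki]
      exact h.length_le D k hk
  · change s.steps D + (project (Q.out ∪ s.otherAttrs {i}) (s.rows D i)).steps ≤ _
    have h1 := h.steps_le D
    have h2 := project_steps_le (Q.out ∪ s.otherAttrs {i}) (s.rows D i)
    have h3 := h.length_le D i hi
    rw [add_mul]
    omega

/-- The semi-join creates the matches on the edge from `i` to `p`. It may destroy matches on the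
edge above `p`, which is why `p` must not belong to `W'` yet. -/
theorem FirstRoundInv.filter (h : FirstRoundInv T rank v W W' b s) {i p : ι} (hi : i ∈ s.nodes)
    (hp : s.parent i = some p) (hpW : p ∉ W') :
    FirstRoundInv T rank v W (insert i W') (b + 3) (s.filter p i) := by
  have hpm := h.tree.parent_mem i hi p hp
  have hpi := h.tree.ne_of_parent hi hp
  have hattrs : (s.filter p i).attrs = s.attrs := Function.update_eq_self _ _
  have hrows : ∀ D, (s.filter p i).rows D = Function.update (s.rows D) p
    (semijoin (s.attrs p ∩ s.attrs i) (s.rows D p) (s.rows D i)).val := fun _ => rfl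
  have hsub : ∀ D, ∀ t ∈ tuples (semijoin (s.attrs p ∩ s.attrs i) (s.rows D p) (s.rows D i)).val,
    t ∈ tuples (s.rows D p) := fun D t ht => (mem_tuples_semijoin.1 ht).1
  refine ⟨h.parent_eq, ?_, h.mem, ?_, fun D => ?_, fun D => ?_, ?_, fun D k hk => ?_,
    fun D => ?_⟩
  · rw [hattrs]
    exact h.tree
  · rw [hattrs]
    exact h.shared
  · rw [hattrs, hrows]
    have hw := (h.represents D).wellFormed p hpm
    refine (h.represents D).filter (hw.semijoin _ _) (hsub D) (fun t ht => ?_)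
      fun t ht => annot_semijoin hw _ _ ht
    have htm := (mem_fullJoin.1 ht).2
    refine mem_tuples_semijoin.2 ⟨htm p hpm, _, htm i hi, ?_⟩
    rw [restrict_restrict_of_subset Finset.inter_subset_right,
      restrict_restrict_of_subset Finset.inter_subset_left]
  · rw [hattrs, hrows]
    have hF := (h.reduced D).filter (hsub D)
      (fun k hk => h.parent_ne_self k (Finset.mem_inter.1 hk).1)
      fun hpW' => absurd (Finset.mem_inter.1 hpW').2 hpW
    intro c hc q hq u hu
    obtain ⟨hc, hcW⟩ := Finset.mem_inter.1 hc
    rcases Finset.mem_insert.1 hcW with rfl | hcW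
    · have hq' : s.parent c = some q := hq
      rw [hp] at hq'
      obtain rfl := Option.some.inj hq'
      rw [Function.update_self] at hu
      rw [Function.update_of_ne hpi.symm]
      obtain ⟨-, w, hw, e⟩ := mem_tuples_semijoin.1 hu
      exact ⟨w, hw, fun a hap hac => restrict_eq_iff.1 e a (Finset.mem_inter.2 ⟨hap, hac⟩)⟩
    · exact hF c (Finset.mem_inter.2 ⟨hc, hcW⟩) q hq u hu
  · intro k hk hkr
    rw [hattrs, hrows]
    by_cases hkp : k = p
    · subst hkp
      rw [Function.update_self]
      have hir : i ≠ T.root := by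
        rintro rfl
        rw [h.tree.parent_root] at hp
        cases hp
      refine mem_tuples_semijoin.2 ⟨h.const_mem k hk hkr, _, h.const_mem i hi hir, ?_⟩
      rw [restrict_constTuple, restrict_constTuple]
      congr 1
      ext a
      simp only [Finset.mem_inter]
      tauto
    · rw [Function.update_of_ne hkp]
      exact h.const_mem k hk hkr
  · rw [hrows]
    by_cases hkp : k = p
    · subst hkp
      rw [Function.update_self]
      exact (semijoin_length_le _ _ _).trans (h.length_le D k hk)
    · rw [Function.update_of_ne hkp]
      exact h.length_le D k hk
  · change s.steps D +
      (semijoin (s.attrs p ∩ s.attrs i) (s.rows D p) (s.rows D i)).steps ≤ _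
    have h1 := h.steps_le D
    have h2 := semijoin_steps_le (s.attrs p ∩ s.attrs i) (s.rows D p) (s.rows D i)
    have h3 := h.length_le D i hi
    have h4 := h.length_le D p hpm
    rw [add_mul]
    omega

/-- As `i` is a leaf, its attributes outside those of `p` occur in no other relation, and by `hO`
they are not output attributes, so they may be projected away. What remains lies over a subset of
the attributes of `p`, hence the join only selects tuples of `p`. -/
theorem FirstRoundInv.absorb (h : FirstRoundInv T rank v W W' b s) {i p : ι} (hi : i ∈ s.nodes)
    (hp : s.parent i = some p) (hpW : p ∉ W) (hpW' : p ∉ W')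
    (hleaf : ∀ j ∈ s.nodes, s.parent j ≠ some i) (hO : s.attrs i ∩ Q.out ⊆ s.attrs p) :
    FirstRoundInv T rank v (insert i W) (insert i W') (b + 5) (s.absorb p i) := by
  have hpm := h.tree.parent_mem i hi p hp
  have hpi := h.tree.ne_of_parent hi hp
  have hattrs : (s.absorb p i).attrs = s.attrs := Function.update_eq_self _ _
  let J : Instance Q V S → List (Row α V S) := fun D =>
    (join (s.attrs p ∩ s.attrs i) (s.rows D p) (project (s.attrs p) (s.rows D i)).val).val
  have hrows : ∀ D, (s.absorb p i).rows D = Function.update (s.rows D) p (J D) := fun _ => rfl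
  have hsubset : s.attrs i ∩ s.attrs p ⊆ s.attrs p := Finset.inter_subset_right
  have hJ : ∀ D, IsJoin (s.attrs p) (s.attrs i ∩ s.attrs p) (s.rows D p)
      (project (s.attrs p) (s.rows D i)).val (J D) := by
    intro D
    have hw := (h.represents D).wellFormed
    have := (hw p hpm).isJoin ((hw i hi).project (s.attrs p))
    have hkey : s.attrs p ∩ (s.attrs i ∩ s.attrs p) = s.attrs p ∩ s.attrs i := by
      ext a
      simp only [Finset.mem_inter]
      tauto
    rwa [hkey] at this
  have hJover : ∀ D, ∀ t ∈ tuples (J D), IsOver (s.attrs p) t := by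
    intro D t ht
    have := (hJ D).wellFormed.isOver t ht
    rwa [Finset.union_eq_left.2 hsubset] at this
  have hsub : ∀ D, ∀ t ∈ tuples (J D), t ∈ tuples (s.rows D p) := by
    intro D t ht
    have := (((hJ D).mem_iff t ((hJ D).wellFormed.isOver t ht)).1 ht).1
    rwa [(hJover D t ht).restrict_self] at this
  have hlen : ∀ D, (J D).length ≤ D.inputSize := by
    intro D
    refine le_trans ?_ (h.length_le D p hpm)
    refine ((hJ D).wellFormed.length_le (F := (tuples (s.rows D p)).toFinset) fun t ht =>
      List.mem_toFinset.2 (hsub D t ht)).trans ?_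
    refine (List.toFinset_card_le _).trans ?_
    rw [tuples, List.length_map]
  have hshare : ∀ k ∈ s.nodes, k ≠ i → ∀ a ∈ s.attrs k, a ∈ s.attrs i → a ∈ s.attrs p := by
    intro k hk hki a hak hai
    refine h.tree.mem_parent hi hk hp hai hak fun hb => ?_
    obtain ⟨c, hc, hci, -⟩ := h.tree.mem_child hi hk hki hai hak hb
    exact hleaf c hc hci
  refine ⟨h.parent_eq, ?_, ?_, ?_, fun D => ?_, fun D => ?_, ?_, fun D k hk => ?_,
    fun D => ?_⟩
  · rw [hattrs]
    exact h.tree.erase hp hleaf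
  · intro k hk
    rw [Finset.mem_insert, not_or] at hk
    exact Finset.mem_erase.2 ⟨hk.1, h.mem k hk.2⟩
  · intro k hk₀ hkW₀ a ha haO
    rw [hattrs] at ha ⊢
    obtain ⟨hki, hk⟩ := Finset.mem_erase.1 hk₀
    have hkW := (Finset.mem_insert.1 hkW₀).resolve_left hki
    obtain ⟨l, hl, hlk, hal⟩ := h.shared k hk hkW a ha haO
    by_cases hli : l = i
    · subst hli
      -- The lost witness `i` is replaced by `p`, which differs from `k` because it has not been
      -- aggregated yet.
      refine ⟨p, Finset.mem_erase.2 ⟨hpi, hpm⟩, ?_, hshare k hk hki a ha hal⟩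
      rintro rfl
      exact hpW hkW
    · exact ⟨l, Finset.mem_erase.2 ⟨hli, hl⟩, hlk, hal⟩
  · rw [hattrs, hrows]
    have h1 := (h.represents D).project hi (Y := s.attrs p)
      (fun a ha hap haO => hap (hO (Finset.mem_inter.2 ⟨ha, haO⟩)))
      (fun a ha hap k hk hki hak => hap (hshare k hk hki a hak ha))
    have h2 := h1.join (p := p) (c := i) (J := J D) hpm hi hpi (by
      rw [Function.update_self, Function.update_self, Function.update_of_ne hpi,
        Function.update_of_ne hpi]
      exact hJ D)
    refine h2.congr (fun k hk => ?_) (fun k hk => ?_)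
    · have hki := (Finset.mem_erase.1 hk).1
      by_cases hkp : k = p
      · subst hkp
        rw [Function.update_self, Function.update_self, Function.update_of_ne hki,
          Finset.union_eq_left.2 hsubset]
      · rw [Function.update_of_ne hkp, Function.update_of_ne hki]
    · have hki := (Finset.mem_erase.1 hk).1
      by_cases hkp : k = p
      · subst hkp
        rw [Function.update_self, Function.update_self]
      · rw [Function.update_of_ne hkp, Function.update_of_ne hkp, Function.update_of_ne hki]
  · rw [hattrs, hrows]
    refine IsReduced.mono (nodes := s.nodes ∩ W') ?_ ?_
    · exact (h.reduced D).filter (hsub D)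
        (fun k hk => h.parent_ne_self k (Finset.mem_inter.1 hk).1)
        fun hpW'' => absurd (Finset.mem_inter.1 hpW'').2 hpW'
    · intro k hk
      obtain ⟨hk, hkW⟩ := Finset.mem_inter.1 hk
      obtain ⟨hki, hk⟩ := Finset.mem_erase.1 hk
      exact Finset.mem_inter.2 ⟨hk, (Finset.mem_insert.1 hkW).resolve_left hki⟩
  · intro k hk₀ hkr
    rw [hattrs, hrows]
    obtain ⟨hki, hk⟩ := Finset.mem_erase.1 hk₀
    by_cases hkp : k = p
    · subst hkp
      rw [Function.update_self]
      have hir : i ≠ T.root := by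
        rintro rfl
        rw [h.tree.parent_root] at hp
        cases hp
      refine ((hJ _).mem_iff _ ?_).2 ⟨?_, mem_tuples_project.2 ⟨_, h.const_mem i hi hir, ?_⟩⟩
      · rw [Finset.union_eq_left.2 hsubset]
        exact isOver_constTuple _ _
      · rw [(isOver_constTuple _ _).restrict_self]
        exact h.const_mem k hk hkr
      · rw [restrict_constTuple, restrict_constTuple, Finset.inter_eq_right.2 hsubset]
    · rw [Function.update_of_ne hkp]
      exact h.const_mem k hk hkr
  · rw [hrows]
    have hk := (Finset.mem_erase.1 hk).2
    by_cases hkp : k = p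
    · subst hkp
      rw [Function.update_self]
      exact hlen D
    · rw [Function.update_of_ne hkp]
      exact h.length_le D k hk
  -- The projection takes at most `2 N` steps and the join `3 N`: both inputs and the output have at
  -- most `N` rows.
  · change s.steps D + ((project (s.attrs p) (s.rows D i)).steps +
      (join (s.attrs p ∩ s.attrs i) (s.rows D p) (project (s.attrs p) (s.rows D i)).val).steps) ≤ _
    have h1 := h.steps_le D
    have h2 := project_steps_le (s.attrs p) (s.rows D i)
    have h3 := h.length_le D i hi
    have h4 := h.length_le D p hpm
    have h5 := join_steps (s.attrs p ∩ s.attrs i) (s.rows D p)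
      (project (s.attrs p) (s.rows D i)).val
    have h6 := project_length_le (s.attrs p) (s.rows D i)
    have h7 : (join (s.attrs p ∩ s.attrs i) (s.rows D p)
      (project (s.attrs p) (s.rows D i)).val).val.length ≤ D.inputSize := hlen D
    rw [add_mul]
    omega

theorem FirstRoundInv.mono_steps (h : FirstRoundInv T rank v W W' b s) {b' : ℕ} (hb : b ≤ b') :
    FirstRoundInv T rank v W W' b' s :=
  { h with steps_le := fun D => (h.steps_le D).trans (Nat.mul_le_mul_right _ hb) }

/-- The visiting order enters through `hp`: the parent is unvisited, so it has neither been
aggregated nor used to reduce its own parent. -/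
theorem FirstRoundInv.firstRoundStep (h : FirstRoundInv T rank v W W b s) {i : ι} (hi : i ∉ W)
    (hp : ∀ p, T.parent i = some p → p ∉ W) :
    FirstRoundInv T rank v (insert i W) (insert i W) (b + 5) (s.firstRoundStep i) := by
  have hin := h.mem i hi
  unfold State.firstRoundStep
  split
  · rename_i p hip
    have hpW := hp p (by rw [← h.parent_eq, hip])
    split_ifs with hc
    · exact h.absorb hin hip hpW hpW hc.1 hc.2
    · exact (h.aggregate hin).filter hin hip hpW
  · rename_i hin'
    have h1 := h.aggregate hin
    refine FirstRoundInv.mono_steps (b := b + 2) ?_ (by omega)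
    refine { h1 with reduced := fun D c hc q hq => ?_ }
    obtain ⟨hc, hcW⟩ := Finset.mem_inter.1 hc
    rcases Finset.mem_insert.1 hcW with rfl | hcW
    · have hq' : s.parent c = some q := hq
      rw [hin'] at hq'
      cases hq'
    · exact h1.reduced D c (Finset.mem_inter.2 ⟨hc, hcW⟩) q hq

theorem FirstRoundInv.foldl {pre l : List ι}
    (h : FirstRoundInv T rank v pre.toFinset pre.toFinset b s) (hl : T.IsBottomUp (pre ++ l)) :
    FirstRoundInv T rank v (pre ++ l).toFinset (pre ++ l).toFinset (b + 5 * l.length)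
      (l.foldl State.firstRoundStep s) := by
  induction l generalizing pre b s with
  | nil => simpa using h
  | cons i l ih =>
    have hl' : T.IsBottomUp ((pre ++ [i]) ++ l) := by simpa using hl
    have hins : (pre ++ [i]).toFinset = insert i pre.toFinset := by
      ext k
      simp only [List.mem_toFinset, List.mem_append, List.mem_singleton, Finset.mem_insert]
      tauto
    have hi : i ∉ pre.toFinset := by
      rw [List.mem_toFinset]
      exact fun hi => (List.nodup_append.1 hl.1).2.2 i hi i (by simp) rfl
    have hp : ∀ p, T.parent i = some p → p ∉ pre.toFinset := by
      intro p hp hpre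
      exact (List.pairwise_append.1 hl.2.2).2.2 p (List.mem_toFinset.1 hpre) i (by simp) hp
    have h1 := h.firstRoundStep hi hp
    rw [← hins] at h1
    have h2 := ih h1 hl'
    rw [List.append_assoc, List.singleton_append] at h2
    rw [List.foldl_cons]
    refine h2.mono_steps ?_
    rw [List.length_cons]
    omega

theorem FirstRoundInv.firstRound (h : IsRootedTree Finset.univ T.parent T.root rank) (v : V)
    {order : List ι} (hl : T.IsBottomUp order) :
    FirstRoundInv T rank v Finset.univ Finset.univ (5 * Fintype.card ι)
      (State.firstRound Q V S T order) := by
  have h1 := FirstRoundInv.foldl (pre := []) (l := order) (FirstRoundInv.start (S := S) h v)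
    (by simpa using hl)
  have h2 : order.toFinset = Finset.univ :=
    Finset.eq_univ_iff_forall.2 fun i => List.mem_toFinset.2 (hl.2.1 i)
  have h3 : order.length = Fintype.card ι := by
    rw [← List.toFinset_card_of_nodup hl.1, h2, Finset.card_univ]
  rw [List.nil_append, h2, h3, zero_add] at h1
  exact h1

end firstRound

/-! ### The second round -/

section secondRound

variable {α : Type uA} {ι : Type uI} {V : Type uV} {S : Type uS}
  [Fintype α] [DecidableEq α] [Fintype ι] [DecidableEq ι] [DecidableEq V] [CommSemiring S]
  {Q : CQ α ι}

theorem State.danglingFree_iff {s : State Q V S} {i : ι} : s.DanglingFree i ↔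
    i ∈ s.nodes ∧ ∀ D, IsDanglingFree s.nodes s.attrs (s.rows D) i := by
  refine and_congr_right fun _ => forall_congr' fun D => ?_
  constructor
  · intro h u hu
    obtain ⟨r, hr, rfl⟩ := mem_tuples.1 hu
    exact h r hr
  · exact fun h r hr => h _ (mem_tuples_of_mem hr)

/-- The bound `min (N * M) F` on the sizes of joins. -/
noncomputable def Instance.joinBound (D : Instance Q V S) : ℕ :=
  min (D.inputSize * D.outputSize) D.joinSize

/-- The invariant of the second round. -/
structure SecondRoundInv (root : ι) (rank : ι → ℕ) (s : State Q V S) : Prop where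
  tree : IsJoinTree s.nodes s.parent s.attrs root rank
  shared : ∀ i ∈ s.nodes, ∀ a ∈ s.attrs i, a ∉ Q.out → ∃ k ∈ s.nodes, k ≠ i ∧ a ∈ s.attrs k
  represents : ∀ D, Represents Q.out D.output D.outputAnnot D.joinSize s.nodes s.attrs (s.rows D)
  reduced : ∀ D, IsReduced s.nodes s.parent s.attrs (s.rows D)
  upward : ∀ i ∈ s.nodes, ∀ p, s.parent i = some p →
    s.DanglingFree p ∨ ∃ D : Instance Q V S, D.output = ∅ ∧ s.rows D i ≠ []
  core : ∀ D, ∀ i ∈ s.nodes, HasCore Q.out D.inputSize (s.attrs i) (s.rows D i)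
  length_le : ∀ D, ∀ i ∈ s.nodes, (s.rows D i).length ≤ D.inputSize + D.joinBound

/-- Initially `upward` holds in its second form, witnessed by the test instance. The full attribute
set is a core, because no relation has more than `N` rows. -/
theorem FirstRoundInv.secondRoundInv {T : JoinTree Q} {rank : ι → ℕ} {v : V} {b : ℕ}
    {s : State Q V S} (h : FirstRoundInv T rank v Finset.univ Finset.univ b s) :
    SecondRoundInv T.root rank s where
  tree := h.tree
  shared i hi := h.shared i hi (Finset.mem_univ i)
  represents := h.represents
  reduced D := by simpa using h.reduced D
  upward i hi p hp := by
    refine Or.inr ⟨_, T.output_rootlessInstance v, fun he => ?_⟩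
    have hir : i ≠ T.root := by
      rintro rfl
      rw [h.tree.parent_root] at hp
      cases hp
    have := h.const_mem i hi hir
    rw [he] at this
    simp [tuples] at this
  core D i hi := HasCore.of_length_le (h.length_le D i hi)
  length_le D i hi := (h.length_le D i hi).trans (Nat.le_add_right _ _)

namespace SecondRoundInv

variable {root : ι} {rank : ι → ℕ} {s : State Q V S}

theorem root_danglingFree (h : SecondRoundInv root rank s) : s.DanglingFree root :=
  State.danglingFree_iff.2 ⟨h.tree.root_mem, fun D =>
    (h.reduced D).root_isDanglingFree h.tree (h.represents D).wellFormed⟩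

/-- Otherwise `upward` provides an instance with empty output on which relation `i` has a tuple;
this tuple would extend to the full join and produce an output tuple. -/
theorem danglingFree_parent (h : SecondRoundInv root rank s) {i p : ι} (hi : s.DanglingFree i)
    (hp : s.parent i = some p) : s.DanglingFree p := by
  refine (h.upward i hi.1 p hp).resolve_right ?_
  rintro ⟨D, hD, hne⟩
  obtain ⟨r, hr⟩ := List.exists_mem_of_ne_nil _ hne
  obtain ⟨t, ht, -⟩ := hi.2 D r hr
  have := Finset.mem_image_of_mem (restrict Q.out) (mem_finiteJoin.2 ht)
  rw [(h.represents D).image_eq, hD] at this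
  exact absurd this (Finset.notMem_empty _)

/-- Apart from output attributes, a relation has only attributes of its reducible neighbours. -/
theorem attrs_subset (h : SecondRoundInv root rank s) {i j : ι} (hj : s.Reducible i j) :
    s.attrs i ⊆ Q.out ∪ s.attrs j := by
  intro a ha
  by_contra hc
  rw [Finset.mem_union, not_or] at hc
  have hi := hj.1.1
  -- A non-output attribute occurs in another relation, hence in a neighbour, and by reducibility
  -- that neighbour can only be `j`.
  obtain ⟨k, hk, hki, hak⟩ := h.shared i hi a ha hc.1
  obtain ⟨c, hcn, hp, hac⟩ := h.tree.mem_neighbor hi hk hki ha hak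
  have hcj : c ≠ j := by
    rintro rfl
    exact hc.2 hac
  exact hc.1 (hj.2 c ⟨hi, hcn, hp⟩ hcj (Finset.mem_inter.2 ⟨hac, ha⟩))

/-! ### Preservation of the invariant of the second round -/

/-- The full join does not change, so dangling-free relations remain so. A surviving tuple of `j`
matches a tuple of the dangling-free parent and can be inserted into a full join tuple extending the
latter, so `j` becomes dangling-free. -/
theorem filter (h : SecondRoundInv root rank s) {i j : ι} (hi : s.DanglingFree i)
    (hj : j ∈ s.nodes) (hij : s.parent j = some i) :
    SecondRoundInv root rank (s.filter j i) ∧ (s.filter j i).DanglingFree j ∧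
      (∀ k, s.DanglingFree k → (s.filter j i).DanglingFree k) ∧
      ∀ D, (s.filter j i).steps D ≤ s.steps D + 5 * (D.inputSize + D.joinBound) := by
  have hne := h.tree.ne_of_parent hj hij
  have hattrs : (s.filter j i).attrs = s.attrs := Function.update_eq_self _ _
  have hrows : ∀ D, (s.filter j i).rows D = Function.update (s.rows D) j
    (semijoin (s.attrs j ∩ s.attrs i) (s.rows D j) (s.rows D i)).val := fun _ => rfl
  have hsub : ∀ D, ∀ t ∈ tuples (semijoin (s.attrs j ∩ s.attrs i) (s.rows D j) (s.rows D i)).val,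
    t ∈ tuples (s.rows D j) := fun D t ht => (mem_tuples_semijoin.1 ht).1
  have hkeep : ∀ D, ∀ t ∈ fullJoin s.nodes s.attrs (s.rows D), restrict (s.attrs j) t ∈
      tuples (semijoin (s.attrs j ∩ s.attrs i) (s.rows D j) (s.rows D i)).val := by
    intro D t ht
    have htm := (mem_fullJoin.1 ht).2
    refine mem_tuples_semijoin.2 ⟨htm j hj, _, htm i hi.1, ?_⟩
    rw [restrict_restrict_of_subset Finset.inter_subset_right,
      restrict_restrict_of_subset Finset.inter_subset_left]
  have hfull : ∀ D, fullJoin (s.filter j i).nodes (s.filter j i).attrs ((s.filter j i).rows D) =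
      fullJoin s.nodes s.attrs (s.rows D) := by
    intro D
    rw [hattrs, hrows]
    exact fullJoin_filter (hsub D) (hkeep D)
  have hdj : (s.filter j i).DanglingFree j := by
    refine State.danglingFree_iff.2 ⟨hj, fun D u hu => ?_⟩
    rw [hfull, hattrs]
    rw [hrows, Function.update_self] at hu
    obtain ⟨hu, w, hw, e⟩ := mem_tuples_semijoin.1 hu
    exact IsDanglingFree.semijoin (h.reduced D) h.tree (h.represents D).wellFormed hj hij
      ((State.danglingFree_iff.1 hi).2 D) hu ⟨w, hw, fun a hai haj =>
        restrict_eq_iff.1 e a (Finset.mem_inter.2 ⟨haj, hai⟩)⟩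
  have hdk : ∀ k, s.DanglingFree k → (s.filter j i).DanglingFree k := by
    intro k hk
    by_cases hkj : k = j
    · exact hkj ▸ hdj
    · refine State.danglingFree_iff.2 ⟨hk.1, fun D => ?_⟩
      rw [IsDanglingFree, hfull, hattrs, hrows, Function.update_of_ne hkj]
      exact (State.danglingFree_iff.1 hk).2 D
  refine ⟨⟨?_, ?_, fun D => ?_, fun D => ?_, fun k hk p hp => ?_, fun D k hk => ?_,
    fun D k hk => ?_⟩, hdj, hdk, fun D => ?_⟩
  · rw [hattrs]
    exact h.tree
  · rw [hattrs]
    exact h.shared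
  · have hw := (h.represents D).wellFormed j hj
    rw [hattrs, hrows]
    exact (h.represents D).filter (hw.semijoin _ _) (hsub D) (hkeep D)
      fun t ht => annot_semijoin hw _ _ ht
  · rw [hattrs, hrows]
    refine (h.reduced D).filter (hsub D) (fun k hk e => h.tree.ne_of_parent hk e rfl) ?_
    intro _ p hp u hu
    rw [hij] at hp
    obtain rfl := Option.some.inj hp
    -- The old match `w` of `u` survives the semi-join, with `u` itself as the reason.
    obtain ⟨w, hw, hwu⟩ := h.reduced D j hj i hij u hu
    refine ⟨w, mem_tuples_semijoin.2 ⟨hw, u, hu, restrict_eq_iff.2 fun a ha => ?_⟩, hwu⟩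
    exact (hwu a (Finset.mem_inter.1 ha).2 (Finset.mem_inter.1 ha).1).symm
  · by_cases hkj : k = j
    · subst hkj
      have hp' : s.parent k = some p := hp
      rw [hij] at hp'
      obtain rfl := Option.some.inj hp'
      exact Or.inl (hdk i hi)
    · refine (h.upward k hk p hp).imp (hdk p) ?_
      rintro ⟨D, hD, hDk⟩
      refine ⟨D, hD, ?_⟩
      rwa [hrows, Function.update_of_ne hkj]
  · rw [hattrs, hrows]
    by_cases hkj : k = j
    · subst hkj
      rw [Function.update_self]
      exact (h.core D k hk).mono (hsub D)
    · rw [Function.update_of_ne hkj]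
      exact h.core D k hk
  · rw [hrows]
    by_cases hkj : k = j
    · subst hkj
      rw [Function.update_self]
      exact (semijoin_length_le _ _ _).trans (h.length_le D k hk)
    · rw [Function.update_of_ne hkj]
      exact h.length_le D k hk
  · change s.steps D +
      (semijoin (s.attrs j ∩ s.attrs i) (s.rows D j) (s.rows D i)).steps ≤ _
    have h2 := semijoin_steps_le (s.attrs j ∩ s.attrs i) (s.rows D j) (s.rows D i)
    have h3 := h.length_le D i hi.1
    have h4 := h.length_le D j hj
    omega

/-- The joined tuples all extend to the current full join. This bounds their number by `F`, and with
the core by `N * M`, because the output parts of full join tuples are the `M` result tuples. -/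
theorem length_join_le (h : SecondRoundInv root rank s) {p c : ι} (hc : c ∈ s.nodes)
    (hp : s.parent c = some p) (hd : s.DanglingFree p) {D : Instance Q V S}
    {J : List (Row α V S)}
    (hJ : IsJoin (s.attrs p) (s.attrs c) (s.rows D p) (s.rows D c) J)
    (hcore : HasCore Q.out D.inputSize (s.attrs p ∪ s.attrs c) J) :
    J.length ≤ D.joinBound := by
  have h1 := ((State.danglingFree_iff.1 hd).2 D).join (h.reduced D) h.tree
    (h.represents D).wellFormed hc hp hJ
  have h2 : ∀ u ∈ tuples J, ∃ t ∈ finiteJoin s.nodes s.attrs (s.rows D),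
      restrict (s.attrs p ∪ s.attrs c) t = u := by
    simpa only [mem_finiteJoin] using h1
  refine le_min ?_ ((length_le_card hJ.wellFormed h2).trans (h.represents D).card_le)
  have h3 := hcore.length_le hJ.wellFormed h2
  rwa [(h.represents D).image_eq] at h3

/-- A merge is an edge contraction with the plain join, followed by a projection of the merged node.
Describing `s'` by equations lets one proof serve both orientations of `merge`. -/
theorem contract (h : SecondRoundInv root rank s) {p c : ι} (hc : c ∈ s.nodes)
    (hp : s.parent c = some p) (hd : s.DanglingFree p) {K : Finset α}
    (hK : K = Q.out ∪ symmDiff (s.attrs p) (s.attrs c) ∪ s.otherAttrs {p, c})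
    {J : Instance Q V S → List (Row α V S)}
    (hJ : ∀ D, IsJoin (s.attrs p) (s.attrs c) (s.rows D p) (s.rows D c) (J D))
    (hcore : ∀ D, HasCore Q.out D.inputSize (s.attrs p ∪ s.attrs c) (J D))
    {s' : State Q V S} (hnodes : s'.nodes = s.nodes.erase c)
    (hparent : s'.parent = contractParent s.parent p c)
    (hattrs : s'.attrs = Function.update s.attrs p ((s.attrs p ∪ s.attrs c) ∩ K))
    (hrows : ∀ D, s'.rows D = Function.update (s.rows D) p (project K (J D)).val) :
    SecondRoundInv root rank s' ∧ ∀ k ∈ s'.nodes, s.DanglingFree k → s'.DanglingFree k := by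
  have hpm := h.tree.parent_mem c hc p hp
  have hpc := h.tree.ne_of_parent hc hp
  have hpe : p ∈ s.nodes.erase c := Finset.mem_erase.2 ⟨hpc, hpm⟩
  have hKmem : ∀ a, a ∈ K ↔ a ∈ Q.out ∨ (a ∈ s.attrs p ∧ a ∉ s.attrs c ∨
      a ∈ s.attrs c ∧ a ∉ s.attrs p) ∨ ∃ k ∈ s.nodes, k ≠ p ∧ k ≠ c ∧ a ∈ s.attrs k := by
    intro a
    rw [hK, Finset.mem_union, Finset.mem_union, Finset.mem_symmDiff, State.mem_otherAttrs, or_assoc]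
    simp only [Finset.mem_insert, Finset.mem_singleton, not_or, and_assoc]
  have hattrs' : s'.attrs = Function.update
      (Function.update s.attrs p (s.attrs p ∪ s.attrs c)) p
      ((Function.update s.attrs p (s.attrs p ∪ s.attrs c)) p ∩ K) := by
    rw [Function.update_self, Function.update_idem, hattrs]
  have hrows' : ∀ D, s'.rows D = Function.update (Function.update (s.rows D) p (J D)) p
      (project K (Function.update (s.rows D) p (J D) p)).val := by
    intro D
    rw [Function.update_self, Function.update_idem, hrows]
  have hO : ∀ a ∈ Function.update s.attrs p (s.attrs p ∪ s.attrs c) p, a ∉ K → a ∉ Q.out :=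
    fun a _ ha ha' => ha ((hKmem a).2 (Or.inl ha'))
  have hY : ∀ a ∈ Function.update s.attrs p (s.attrs p ∪ s.attrs c) p, a ∉ K →
      ∀ k ∈ s.nodes.erase c, k ≠ p →
        a ∉ Function.update s.attrs p (s.attrs p ∪ s.attrs c) k := by
    intro a _ haK k hk hkp hak
    rw [Function.update_of_ne hkp] at hak
    obtain ⟨hkc, hk⟩ := Finset.mem_erase.1 hk
    exact haK ((hKmem a).2 (Or.inr (Or.inr ⟨k, hk, hkp, hkc, hak⟩)))
  have hproj : ∀ D, IsProjection K (Function.update (s.rows D) p (J D) p)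
    (project K (Function.update (s.rows D) p (J D) p)).val := fun D t => mem_tuples_project
  have htree := h.tree.contract hc hp
  have hdk : ∀ k ∈ s'.nodes, s.DanglingFree k → s'.DanglingFree k := by
    intro k hk hdk
    refine State.danglingFree_iff.2 ⟨hk, fun D => ?_⟩
    rw [hnodes] at hk ⊢
    rw [hattrs', hrows']
    refine IsDanglingFree.project ?_ hk hpe (hproj D)
    rw [IsDanglingFree, fullJoin_join hpm hc hpc (hJ D)]
    by_cases hkp : k = p
    · subst hkp
      rw [Function.update_self, Function.update_self]
      exact ((State.danglingFree_iff.1 hdk).2 D).join (h.reduced D) h.tree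
        (h.represents D).wellFormed hc hp (hJ D)
    · rw [Function.update_of_ne hkp, Function.update_of_ne hkp]
      exact (State.danglingFree_iff.1 hdk).2 D
  refine ⟨⟨?_, ?_, fun D => ?_, fun D => ?_, fun k hk₀ q hq => ?_, fun D k hk₀ => ?_,
    fun D k hk₀ => ?_⟩, hdk⟩
  · rw [hnodes, hparent, hattrs']
    exact htree.project hY
  · intro k hk₀ a ha haO
    rw [hnodes] at hk₀ ⊢
    rw [hattrs] at ha ⊢
    obtain ⟨hkc, hk⟩ := Finset.mem_erase.1 hk₀
    by_cases hkp : k = p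
    · subst hkp
      rw [Function.update_self] at ha
      obtain ⟨ha, haK⟩ := Finset.mem_inter.1 ha
      -- A kept non-output attribute occurs in a third relation: if only one of the merged relations
      -- has it, the `shared` witness of that relation is not the other one.
      have : ∃ l ∈ s.nodes, l ≠ k ∧ l ≠ c ∧ a ∈ s.attrs l := by
        rcases (hKmem a).1 haK with h1 | (⟨h1, h2⟩ | ⟨h1, h2⟩) | h1
        · exact absurd h1 haO
        · obtain ⟨l, hl, hlk, hal⟩ := h.shared k hk a h1 haO
          exact ⟨l, hl, hlk, fun e => h2 (e ▸ hal), hal⟩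
        · obtain ⟨l, hl, hlc, hal⟩ := h.shared c hc a h1 haO
          exact ⟨l, hl, fun e => h2 (e ▸ hal), hlc, hal⟩
        · exact h1
      obtain ⟨l, hl, hlk, hlc, hal⟩ := this
      exact ⟨l, Finset.mem_erase.2 ⟨hlc, hl⟩, hlk, by rwa [Function.update_of_ne hlk]⟩
    · rw [Function.update_of_ne hkp] at ha
      have haK : a ∈ K := (hKmem a).2 (Or.inr (Or.inr ⟨k, hk, hkp, hkc, ha⟩))
      obtain ⟨l, hl, hlk, hal⟩ := h.shared k hk a ha haO
      by_cases hl' : l = p ∨ l = c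
      · refine ⟨p, hpe, Ne.symm hkp, ?_⟩
        rw [Function.update_self, Finset.mem_inter, Finset.mem_union]
        rcases hl' with rfl | rfl
        · exact ⟨Or.inl hal, haK⟩
        · exact ⟨Or.inr hal, haK⟩
      · rw [not_or] at hl'
        exact ⟨l, Finset.mem_erase.2 ⟨hl'.2, hl⟩, hlk, by rwa [Function.update_of_ne hl'.1]⟩
  · rw [hnodes, hattrs', hrows']
    exact ((h.represents D).join hpm hc hpc (hJ D)).project hpe hO hY
  · rw [hnodes, hparent, hattrs', hrows']
    exact ((h.reduced D).contract h.tree (h.represents D).wellFormed hc hp (hJ D)).project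
      (hproj D) fun k hk e => htree.ne_of_parent hk e rfl
  · have hpd : s'.DanglingFree p := hdk p (hnodes ▸ hpe) hd
    have hk₁ := hk₀
    rw [hnodes] at hk₁
    obtain ⟨hkc, hk⟩ := Finset.mem_erase.1 hk₁
    rw [hparent, contractParent] at hq
    split_ifs at hq with hkc'
    · obtain rfl := Option.some.inj hq
      exact Or.inl hpd
    · have hqc : q ≠ c := by
        rintro rfl
        exact hkc' hq
      have hq' : s.DanglingFree q → s'.DanglingFree q := fun hdq =>
        hdk q (by rw [hnodes]; exact Finset.mem_erase.2 ⟨hqc, hdq.1⟩) hdq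
      -- The content of `p` has changed, so an obstruction instance for the edge above `p` may be
      -- lost. But `p` was dangling-free, hence so is its parent.
      by_cases hkp : k = p
      · subst hkp
        exact Or.inl (hq' (h.danglingFree_parent hd hq))
      · refine (h.upward k hk q hq).imp hq' ?_
        rintro ⟨D, hD, hDk⟩
        refine ⟨D, hD, ?_⟩
        rwa [hrows, Function.update_of_ne hkp]
  · rw [hnodes] at hk₀
    have hk := (Finset.mem_erase.1 hk₀).2
    rw [hattrs, hrows]
    by_cases hkp : k = p
    · subst hkp
      rw [Function.update_self, Function.update_self]
      exact (hcore D).project fun t => mem_tuples_project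
    · rw [Function.update_of_ne hkp, Function.update_of_ne hkp]
      exact h.core D k hk
  · rw [hnodes] at hk₀
    have hk := (Finset.mem_erase.1 hk₀).2
    rw [hrows]
    by_cases hkp : k = p
    · subst hkp
      rw [Function.update_self]
      have h1 := project_length_le K (J D)
      have h2 := h.length_join_le hc hp hd (hJ D) (hcore D)
      omega
    · rw [Function.update_of_ne hkp]
      exact h.length_le D k hk

/-- The upper node is dangling-free in both orientations, by `danglingFree_parent` if it is `j`. The
core of the join always comes from `j`, through `attrs_subset`. -/
theorem merge (h : SecondRoundInv root rank s) {i j : ι} (hi : s.DanglingFree i)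
    (hj : s.Reducible i j) :
    SecondRoundInv root rank (s.merge i j) ∧
      (s.merge i j).nodes.card < s.nodes.card ∧ (s.merge i j).nodes ⊆ s.nodes ∧
      (∀ k ∈ (s.merge i j).nodes, s.DanglingFree k → (s.merge i j).DanglingFree k) ∧
      ∀ D, (s.merge i j).steps D ≤ s.steps D + 5 * (D.inputSize + D.joinBound) := by
  obtain ⟨him, hjm, hnb⟩ := hj.1
  let K := Q.out ∪ symmDiff (s.attrs i) (s.attrs j) ∪ s.otherAttrs {i, j}
  let J : Instance Q V S → List (Row α V S) := fun D =>
    (join (s.attrs i ∩ s.attrs j) (s.rows D i) (s.rows D j)).val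
  have hJ : ∀ D, IsJoin (s.attrs i) (s.attrs j) (s.rows D i) (s.rows D j) (J D) := fun D =>
    ((h.represents D).wellFormed i him).isJoin ((h.represents D).wellFormed j hjm)
  have hcore : ∀ D, HasCore Q.out D.inputSize (s.attrs i ∪ s.attrs j) (J D) := fun D =>
    (h.core D j hjm).join (hJ D) (h.attrs_subset hj)
  have hsteps : (∀ D, (J D).length ≤ D.joinBound) →
      ∀ D, (s.merge i j).steps D ≤ s.steps D + 5 * (D.inputSize + D.joinBound) := by
    intro hlen D
    change s.steps D + ((join (s.attrs i ∩ s.attrs j) (s.rows D i) (s.rows D j)).steps +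
      (project K (J D)).steps) ≤ _
    -- With `B` the `joinBound`, the join reads two relations of at most `N + B` rows and writes at
    -- most `B` rows; the projection adds at most `2 B` steps.
    have h1 : (join (s.attrs i ∩ s.attrs j) (s.rows D i) (s.rows D j)).steps =
      (s.rows D j).length + (s.rows D i).length + (J D).length := join_steps _ _ _
    have h2 := project_steps_le K (J D)
    have h3 := h.length_le D i him
    have h4 := h.length_le D j hjm
    have h5 := hlen D
    omega
  by_cases hp : s.parent i = some j
  · have hd := h.danglingFree_parent hi hp
    have hcore' : ∀ D, HasCore Q.out D.inputSize (s.attrs j ∪ s.attrs i) (J D) := fun D =>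
      Finset.union_comm (s.attrs i) (s.attrs j) ▸ hcore D
    have hnodes : (s.merge i j).nodes = s.nodes.erase i := by simp [State.merge, hp]
    obtain ⟨h1, h2⟩ := h.contract (s' := s.merge i j) (K := K) (J := J) him hp hd
      (by rw [symmDiff_comm, Finset.pair_comm]) (fun D => (hJ D).symm) hcore' hnodes
      (by simp only [State.merge, hp, if_true]; rfl)
      (by simp only [State.merge, State.assign, hp, if_true]; rw [Finset.union_comm (s.attrs i)])
      (fun D => by simp only [State.merge, State.assign, hp, if_true]; rfl)
    exact ⟨h1, hnodes ▸ Finset.card_erase_lt_of_mem him, hnodes ▸ Finset.erase_subset _ _, h2,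
      hsteps fun D => h.length_join_le him hp hd (hJ D).symm (hcore' D)⟩
  · have hp' := hnb.resolve_left hp
    have hnodes : (s.merge i j).nodes = s.nodes.erase j := by simp [State.merge, hp]
    obtain ⟨h1, h2⟩ := h.contract (s' := s.merge i j) (K := K) (J := J) hjm hp' hi
      rfl hJ hcore hnodes
      (by simp only [State.merge, hp, if_false]; rfl)
      (by simp only [State.merge, State.assign, hp, if_false]; rfl)
      (fun D => by simp only [State.merge, State.assign, hp, if_false]; rfl)
    exact ⟨h1, hnodes ▸ Finset.card_erase_lt_of_mem hjm, hnodes ▸ Finset.erase_subset _ _, h2,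
      hsteps fun D => h.length_join_le hjm hp' hi (hJ D) (hcore D)⟩

end SecondRoundInv

/-! ### Termination and total cost of the second round -/

open Classical in
/-- The number of relations plus the number of those that are not dangling-free. -/
noncomputable def State.potential (s : State Q V S) : ℕ :=
  s.nodes.card + (s.nodes.filter fun i => ¬ s.DanglingFree i).card

theorem State.potential_le (s : State Q V S) : s.potential ≤ 2 * Fintype.card ι := by
  classical
  have h1 := Finset.card_le_univ s.nodes
  have h2 := Finset.card_le_univ (s.nodes.filter fun i => ¬ s.DanglingFree i)
  unfold State.potential
  convert Nat.add_le_add h1 h2 using 1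
  omega

namespace SecondRoundInv

variable {root : ι} {rank : ι → ℕ} {s s' : State Q V S}

/-- A merge removes a node and spoils no dangling-free relation that remains; a semi-join keeps the
nodes and makes one more of them dangling-free. -/
theorem step (h : SecondRoundInv root rank s) (hs : s.SecondRoundStep s') :
    SecondRoundInv root rank s' ∧ s'.potential < s.potential ∧
      ∀ D, s'.steps D ≤ s.steps D + 5 * (D.inputSize + D.joinBound) := by
  classical
  cases hs with
  | reduce i j hi hj =>
    obtain ⟨h1, h2, h3, h4, h5⟩ := h.merge hi hj
    refine ⟨h1, Nat.add_lt_add_of_lt_of_le h2 (Finset.card_le_card fun k hk => ?_), h5⟩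
    obtain ⟨hk, hkd⟩ := Finset.mem_filter.1 hk
    exact Finset.mem_filter.2 ⟨h3 hk, fun hd => hkd (h4 k hk hd)⟩
  | semijoinChild i j hnone hi hj hij hjd =>
    obtain ⟨h1, h2, h3, h4⟩ := h.filter hi hj hij
    refine ⟨h1, Nat.add_lt_add_of_le_of_lt le_rfl (Finset.card_lt_card ?_), h4⟩
    refine (Finset.ssubset_iff_of_subset fun k hk => ?_).2 ⟨j, Finset.mem_filter.2 ⟨hj, hjd⟩,
      fun hc => (Finset.mem_filter.1 hc).2 h2⟩
    obtain ⟨hk, hkd⟩ := Finset.mem_filter.1 hk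
    exact Finset.mem_filter.2 ⟨hk, fun hd => hkd (h3 k hd)⟩

/-- Amortization: each unit of potential pays for one step of cost at most `5 (N + B)`. -/
theorem reflTransGen (h : SecondRoundInv root rank s)
    (hs : Relation.ReflTransGen State.SecondRoundStep s s') :
    SecondRoundInv root rank s' ∧ ∀ D, s'.steps D + 5 * (D.inputSize + D.joinBound) * s'.potential ≤
      s.steps D + 5 * (D.inputSize + D.joinBound) * s.potential := by
  induction hs with
  | refl => exact ⟨h, fun D => le_rfl⟩
  | tail _ hs ih =>
    obtain ⟨h1, h2, h3⟩ := ih.1.step hs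
    refine ⟨h1, fun D => le_trans ?_ (ih.2 D)⟩
    have h4 := Nat.mul_le_mul_left (5 * (D.inputSize + D.joinBound)) (Nat.succ_le_of_lt h2)
    have h5 := h3 D
    rw [Nat.succ_eq_add_one, mul_add, mul_one] at h4
    omega

theorem not_infinite (h : SecondRoundInv root rank s) :
    ¬ ∃ run : ℕ → State Q V S, run 0 = s ∧ ∀ k, (run k).SecondRoundStep (run (k + 1)) := by
  rintro ⟨run, h0, hrun⟩
  have hinv : ∀ k, SecondRoundInv root rank (run k) := by
    intro k
    induction k with
    | zero => exact h0 ▸ h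
    | succ k ih => exact (ih.step (hrun k)).1
  have hlt : StrictAnti fun k => (run k).potential :=
    strictAnti_nat_of_succ_lt fun k => ((hinv k).step (hrun k)).2.1
  exact not_strictAnti_of_wellFoundedLT _ hlt

/-- Unless only the root is left, the second round can go on. -/
theorem nodes_eq (h : SecondRoundInv root rank s) (hs : ∀ s', ¬ s.SecondRoundStep s') :
    s.nodes = {root} := by
  classical
  by_contra hne
  have hex : ∃ k ∈ s.nodes, k ≠ root := by
    by_contra! hc
    exact hne (Finset.eq_singleton_iff_unique_mem.2 ⟨h.tree.root_mem, hc⟩)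
  have hnone : ∀ i j, s.DanglingFree i → ¬ s.Reducible i j := fun i j hi hj =>
    hs _ (.reduce i j hi hj)
  by_cases hall : ∀ k ∈ s.nodes, s.DanglingFree k
  -- If all relations are dangling-free, a node of maximal rank is a leaf; its parent is its only
  -- neighbour and therefore reducible for it.
  · obtain ⟨k₀, hk₀, hk₀r⟩ := hex
    obtain ⟨k, hk, hmax⟩ := Finset.exists_max_image s.nodes rank ⟨k₀, hk₀⟩
    have hkr : k ≠ root := by
      rintro rfl
      obtain ⟨p, hp⟩ := h.tree.exists_parent k₀ hk₀ hk₀r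
      have h1 := h.tree.rank_lt k₀ hk₀ p hp
      have h2 := hmax k₀ hk₀
      -- Descent along parents shows that the root has least rank, so its rank is below that of `k₀`
      -- and not maximal.
      have h3 : ∀ n : ℕ, ∀ l ∈ s.nodes, rank l = n → rank k ≤ n := by
        intro n
        induction n using Nat.strong_induction_on with
        | _ n ih =>
          intro l hl hln
          by_cases hlk : l = k
          · rw [← hln, hlk]
          · obtain ⟨q, hq⟩ := h.tree.exists_parent l hl hlk
            have h4 := h.tree.rank_lt l hl q hq
            have h5 := ih (rank q) (by omega) q (h.tree.parent_mem l hl q hq) rfl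
            omega
      have h4 := h3 _ p (h.tree.parent_mem k₀ hk₀ p hp) rfl
      omega
    obtain ⟨p, hp⟩ := h.tree.exists_parent k hk hkr
    refine hnone k p (hall k hk) ⟨⟨hk, h.tree.parent_mem k hk p hp, Or.inl hp⟩, ?_⟩
    rintro m ⟨-, hm, hmp⟩ hne
    rcases hmp with hmp | hmp
    · rw [hp] at hmp
      exact absurd (Option.some.inj hmp).symm hne
    · have h1 := h.tree.rank_lt m hm k hmp
      have h2 := hmax m hm
      omega
  · push Not at hall
    obtain ⟨k₀, hk₀, hk₀d⟩ := hall
    -- A relation of least rank among those not dangling-free is not the root, and its parent is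
    -- dangling-free.
    obtain ⟨k, hk, hmin⟩ := Finset.exists_min_image
      (s.nodes.filter fun i => ¬ s.DanglingFree i) rank ⟨k₀, Finset.mem_filter.2 ⟨hk₀, hk₀d⟩⟩
    obtain ⟨hk, hkd⟩ := Finset.mem_filter.1 hk
    obtain ⟨p, hp⟩ := h.tree.exists_parent k hk fun e => hkd (e ▸ h.root_danglingFree)
    have hpd : s.DanglingFree p := by
      by_contra hpd
      have h1 := hmin p (Finset.mem_filter.2 ⟨h.tree.parent_mem k hk p hp, hpd⟩)
      have h2 := h.tree.rank_lt k hk p hp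
      omega
    exact hs _ (.semijoinChild p k hnone hpd hk hp hkd)

/-- A single remaining relation is the annotated result. -/
theorem isResult (h : SecondRoundInv root rank s) (hs : s.nodes = {root}) (D : Instance Q V S) :
    D.IsResult (s.rows D root) := by
  have hr := h.represents D
  have hA : s.attrs root = Q.out := by
    refine Finset.Subset.antisymm (fun a ha => ?_) ?_
    -- A non-output attribute would have to occur in a second relation.
    · by_contra haO
      obtain ⟨k, hk, hkr, -⟩ := h.shared root h.tree.root_mem a ha haO
      rw [hs, Finset.mem_singleton] at hk
      exact hkr hk
    · have := hr.out_subset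
      rwa [hs, Finset.singleton_biUnion] at this
  have hw := hr.wellFormed root h.tree.root_mem
  have hres : ∀ t ∈ tuples (s.rows D root), restrict Q.out t = t := fun t ht =>
    hA ▸ (hw.isOver t ht).restrict_self
  have hmem : ∀ t, t ∈ finiteJoin s.nodes s.attrs (s.rows D) ↔ t ∈ tuples (s.rows D root) := by
    intro t
    rw [mem_finiteJoin, mem_fullJoin, hs, Finset.singleton_biUnion]
    constructor
    · rintro ⟨h1, h2⟩
      have := h2 root (Finset.mem_singleton_self _)
      rwa [h1.restrict_self] at this
    · intro ht
      refine ⟨hw.isOver t ht, fun i hi => ?_⟩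
      rw [Finset.mem_singleton.1 hi, (hw.isOver t ht).restrict_self]
      exact ht
  refine ⟨hw.nodup, fun u => ?_, fun r hrm => ?_⟩
  · rw [← hr.image_eq, Finset.mem_image]
    constructor
    · exact fun hu => ⟨u, (hmem u).2 hu, hres u hu⟩
    · rintro ⟨t, ht, rfl⟩
      have ht := (hmem t).1 ht
      rwa [hres t ht]
  · have hrt := mem_tuples_of_mem hrm
    have hf : (finiteJoin s.nodes s.attrs (s.rows D)).filter (fun t => restrict Q.out t = r.1) =
        {r.1} := by
      ext t
      rw [Finset.mem_filter, hmem, Finset.mem_singleton]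
      constructor
      · rintro ⟨ht, e⟩
        rwa [hres t ht] at e
      · rintro rfl
        exact ⟨hrt, hres _ hrt⟩
    rw [← hr.sum_eq r.1, hf, Finset.sum_singleton, weight, hs, Finset.prod_singleton, hA,
      hres _ hrt, annot_eq hw hrm]

end SecondRoundInv

end secondRound

end YannakakisPlus

open YannakakisPlus
theorem mainTheorem1 {α : Type*} {ι : Type*} [Fintype α] [DecidableEq α] [Fintype ι]
    [DecidableEq ι] (Q : CQ α ι) :
    ∃ C : ℕ, ∀ (T : JoinTree Q) (order : List ι), T.IsBottomUp order →
      ∀ (V : Type*) (S : Type*) [DecidableEq V] [Nonempty V] [CommSemiring S],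
        (¬ ∃ run : ℕ → State Q V S, run 0 = State.firstRound Q V S T order ∧
          ∀ k, (run k).SecondRoundStep (run (k + 1))) ∧
        ∀ s : State Q V S,
          Relation.ReflTransGen State.SecondRoundStep (State.firstRound Q V S T order) s →
          (∀ s', ¬ s.SecondRoundStep s') →
          ∃ i, s.nodes = {i} ∧ ∀ D : Instance Q V S,
            D.IsResult (s.rows D i) ∧
            s.steps D ≤ C * (D.inputSize + min (D.inputSize * D.outputSize) D.joinSize) ∧
            (1 ≤ D.outputSize → D.inputSize ≤ D.joinSize →
              s.steps D ≤ C * min (D.inputSize * D.outputSize) D.joinSize) := by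
  -- With `n` relations and `B` the `joinBound`, the rounds cost at most `5 n N` and `2 n * 5 (N +
  -- B)`, together at most `15 n (N + B)`. The factor is doubled for the last claim, where `N ≤ B`.
  refine ⟨30 * Fintype.card ι, fun T order horder V S _ _ _ => ?_⟩
  obtain ⟨rank, hrank⟩ := T.exists_rank
  -- This value fills the constant tuples of the test instance.
  obtain ⟨v⟩ := ‹Nonempty V›
  have h₁ := FirstRoundInv.firstRound (S := S) hrank v horder
  have h₂ := h₁.secondRoundInv
  refine ⟨h₂.not_infinite, fun s hs hfinal => ?_⟩
  obtain ⟨h₃, hsteps⟩ := h₂.reflTransGen hs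
  have hn := h₃.nodes_eq hfinal
  refine ⟨T.root, hn, fun D => ?_⟩
  have key : s.steps D ≤ 15 * Fintype.card ι * (D.inputSize + D.joinBound) := by
    have e₁ := hsteps D
    have e₂ := h₁.steps_le D
    have e₃ := Nat.mul_le_mul_left (5 * (D.inputSize + D.joinBound))
      (State.firstRound Q V S T order).potential_le
    nlinarith [Nat.zero_le (5 * (D.inputSize + D.joinBound) * s.potential),
      Nat.zero_le (Fintype.card ι * D.joinBound)]
  refine ⟨h₃.isResult hn D, key.trans (Nat.mul_le_mul_right _ (by omega)), fun hM hF => ?_⟩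
  have hN : D.inputSize ≤ D.joinBound := le_min (Nat.le_mul_of_pos_right _ hM) hF
  calc s.steps D ≤ 15 * Fintype.card ι * (D.inputSize + D.joinBound) := key
    _ ≤ 15 * Fintype.card ι * (2 * D.joinBound) := Nat.mul_le_mul_left _ (by omega)
    _ = 30 * Fintype.card ι * D.joinBound := by ring
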